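/- **Definitions.** Write $[n]=\{1,\dots,n\}$. *Bi-words.* A prime parking function of length $n$ is a word $w$ of length $n$ on the positive integers whose nondecreasing rearrangement $w'_1\le\dots\le w'_n$ satisfies $w'_i\le i$ for all $i$ and $w'_i<i$ for all $i\ge 2$ (the empty word is one). A bi-word of length $n$ is an infinite sequence of columns $(L_i,M_i)_{i\ge1}$ such that the nonempty sets $L_i$ form an ordered set partition of $[n]$ and $M_i$ is a prime parking function of length $|L_i|$. It encodes the word $w$ of length $n$ whose letter at the position given by the $j$-th smallest element of $L_i$ is the $j$-th letter of $M_i$ plus $\sum_{p<i}\max(1,|L_p|)$; this is a bijection between bi-words of length $n$ and words of length $n$ on the positive integers. The group $\mathfrak S_\infty$ generated by the elementary transpositions $s_i$ acts on bi-words: under the $\infty$-action, $s_i$ exchanges the $i$-th and $(i+1)$-st columns. *The vectors $\mathbf G^{(\infty)}_u$.* An $\infty$-bi-word $u$ of length $n$ with $k$ nonempty columns is a finite sequence $(L_1,M_1),\dots,(L_k,M_k)$ such that $L_1,\dots,L_k$ are nonempty and form a set partition of $[n]$, $\min L_1<\dots<\min L_k$, and $M_i$ is a prime parking function of length $|L_i|$;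 it is viewed as a bi-word by appending empty columns. For such $u$ let $\mathbf G^{(\infty)}_u=\sum_w w$, a formal sum (with coefficients in a field $\mathbb K$ of characteristic $0$) over all words $w$ on the positive integers that are encoded by the bi-words in the orbit of $u$ under the $\infty$-action. *The numbers $A^\infty_{n,k}$.* Let $$A^{\infty}_{n,k}=\sum_{\{Q_1,\dots,Q_k\}}\ \prod_{i=1}^k(|Q_i|-1)^{|Q_i|-1},$$ the sum being over the set partitions of $[n]$ into $k$ (nonempty) parts, with $0^0=1$. *Trees.* For a rooted labeled (non-planar) tree $T$ with vertices in $[n]$, the maximal decreasing subtree $MD(T)$ is the maximal subtree that contains the root and whose edges are decreasing (every vertex of it other than the root is smaller than its parent). Let $T_{n,k}$ be the set of rooted labeled trees on $[n+1]$ such that $MD(T)$ has $k+1$ vertices, and $T'_{n,k}$ the set of rooted labeled trees on $[n]$ such that $MD(T)$ is a chain (each of its vertices has at most one child in it) with $k$ vertices. Let $S(m,k)$ be the Stirling numbers of the second kind. **Statement.** Let $n\ge1$ and $1\le k\le n$. There is a bijection between the set of the vectors $\mathbf G^{(\infty)}_u$, where $u$ is an $\infty$-bi-word of length $n$ with $k$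 nonempty columns, and the set $T'_{n,k}$. Moreover $$A^{\infty}_{n+1,k+1}=\frac{|T_{n,k}|}{k!}=\sum_{m=k}^{n}\binom nm S(m,k)\,(n-k)^{n-m}=\frac1{k!}\sum_{i=0}^{k}(-1)^i\binom ki(n-i)^n .$$ -/

import Mathlib

open scoped Nat

/-! ### Parking functions -/

/-- Words on the positive integers. -/
abbrev PosWord : Type := List ℕ+

/-- The nondecreasing rearrangement of a word. -/
def PosWord.rearr (w : PosWord) : PosWord := w.insertionSort (· ≤ ·)

/-- `w = w₁ … wₙ` is a parking function: its nondecreasing rearrangement `w'` has `w'ᵢ ≤ i` for all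
`1 ≤ i ≤ n` (positions are counted from `0` in the code, so `i` reads `i + 1`). -/
def IsParking (w : PosWord) : Prop :=
  ∀ (i : ℕ) (hi : i < w.rearr.length), ((w.rearr[i] : ℕ+) : ℕ) ≤ i + 1

/-- A prime parking function: a parking function whose nondecreasing rearrangement `w'` satisfies
`w'ᵢ < i` for all `i ≥ 2`. The empty word is one. -/
def IsPrimeParking (w : PosWord) : Prop :=
  IsParking w ∧
    ∀ (i : ℕ) (hi : i < w.rearr.length), 1 ≤ i → ((w.rearr[i] : ℕ+) : ℕ) < i + 1

/-! ### Bi-words -/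

/-- A column: a set `L` of positions on top of a word `M`. -/
abbrev BiColumn : Type := Finset ℕ × PosWord

/-- The set `BW_n` of bi-words of length `n`: infinite sequences of columns `(Lᵢ, Mᵢ)` such that the
nonempty `Lᵢ` form a set composition of `{1, …, n}` and `Mᵢ` is a prime parking function of length
`|Lᵢ|`. (Columns are numbered from `0`.) -/
@[ext] structure BiWord (n : ℕ) where
  col : ℕ → BiColumn
  disjoint' : ∀ i j, i ≠ j → Disjoint (col i).1 (col j).1
  cover' : ∀ x, (∃ i, x ∈ (col i).1) ↔ x ∈ Finset.Icc 1 n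
  prime' : ∀ i, IsPrimeParking (col i).2
  length' : ∀ i, (col i).2.length = (col i).1.card

namespace BiWord

variable {n : ℕ}

/-- The number of the column of `m` whose set contains the position `x`. -/
def colOf (m : BiWord n) (x : ℕ) (hx : x ∈ Finset.Icc 1 n) : ℕ := Nat.find ((m.cover' x).2 hx)

theorem mem_colOf (m : BiWord n) (x : ℕ) (hx : x ∈ Finset.Icc 1 n) :
    x ∈ (m.col (m.colOf x hx)).1 := Nat.find_spec ((m.cover' x).2 hx)

/-- The rank (counted from `0`) of `x` in the set of the `i`-th column. -/
def rankIn (m : BiWord n) (i x : ℕ) : ℕ := ((m.col i).1.filter (· < x)).card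

theorem rankIn_lt (m : BiWord n) (i x : ℕ) (hx : x ∈ (m.col i).1) :
    m.rankIn i x < (m.col i).2.length := by
  rw [m.length', rankIn]
  exact Finset.card_lt_card (Finset.filter_ssubset.2 ⟨x, hx, lt_irrefl x⟩)

/-- The increment of the letters of column `i`: the sum of the `|L_p|` for `p < i`, where an empty
column counts for `1`. -/
def offset (m : BiWord n) (i : ℕ) : ℕ :=
  ∑ p ∈ Finset.range i, if (m.col p).1 = ∅ then 1 else (m.col p).1.card

/-- The letter at position `x` of the word encoded by `m`: if `x` is the `j`-th element of `Lᵢ`, it is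
the `j`-th letter of `Mᵢ` incremented by the offset of column `i`. -/
def letter (m : BiWord n) (x : ℕ) (hx : x ∈ Finset.Icc 1 n) : ℕ+ :=
  ⟨(((m.col (m.colOf x hx)).2[m.rankIn (m.colOf x hx) x]'(m.rankIn_lt _ x (m.mem_colOf x hx)) : ℕ+) : ℕ)
      + m.offset (m.colOf x hx),
    Nat.add_pos_left (PNat.pos _) _⟩

/-- The word on the positive integers encoded by a bi-word (the bijection from bi-words of length `n`
to words of length `n`). -/
def toWord (m : BiWord n) : PosWord :=
  List.ofFn fun p : Fin n => m.letter (p + 1) (Finset.mem_Icc.2 ⟨Nat.le_add_left _ _, p.2⟩)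

/-- Exchange the columns `i` and `i + 1`. -/
def swapCols (i : ℕ) (m : BiWord n) : BiWord n where
  col j := m.col (Equiv.swap i (i + 1) j)
  disjoint' a b hab := m.disjoint' _ _ fun h => hab ((Equiv.swap i (i + 1)).injective h)
  cover' x := by
    rw [← m.cover' x]
    exact (Equiv.swap i (i + 1)).surjective.exists (p := fun j => x ∈ (m.col j).1) |>.symm
  prime' j := m.prime' _
  length' j := m.length' _

/-- The `r`-action of the elementary transposition `sᵢ`: exchange the columns `i` and `i + 1` if one of
them has words of length strictly smaller than `r`, and do nothing otherwise. -/
noncomputable def simpleAct (r : ℕ∞) (i : ℕ) (m : BiWord n) : BiWord n :=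
  open Classical in
  if ((m.col i).2.length : ℕ∞) < r ∨ ((m.col (i + 1)).2.length : ℕ∞) < r then m.swapCols i else m

theorem simpleAct_involutive (r : ℕ∞) (i : ℕ) :
    Function.Involutive (simpleAct (n := n) r i) := by
  intro m
  by_cases h : ((m.col i).2.length : ℕ∞) < r ∨ ((m.col (i + 1)).2.length : ℕ∞) < r
  · have h' : (((m.swapCols i).col i).2.length : ℕ∞) < r ∨
        (((m.swapCols i).col (i + 1)).2.length : ℕ∞) < r := by
      simpa [swapCols] using h.symm
    rw [simpleAct, simpleAct, if_pos h, if_pos h']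
    ext1
    funext j
    simp [swapCols]
  · rw [simpleAct, simpleAct, if_neg h, if_neg h]

/-- The permutation of the bi-words of length `n` by which `sᵢ` acts. -/
noncomputable def simplePerm (r : ℕ∞) (i : ℕ) : Equiv.Perm (BiWord n) :=
  (simpleAct_involutive r i).toPerm

/-- The orbit of `m` under the `r`-action of the infinite symmetric group, that is, under the group
generated by the permutations by which the `sᵢ` act. -/
def orbit (r : ℕ∞) (m : BiWord n) : Set (BiWord n) :=
  MulAction.orbit (Subgroup.closure (Set.range (simplePerm (n := n) r))) m

end BiWord

/-! ### `r`-bi-words and the vectors `G` -/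

/-- An `r`-bi-word of length `n`: a pair `(I, lam)` of finite sequences of columns, the sets in `I`
having at least `r` elements and those in `lam` fewer than `r`, with the sets of `lam` sorted by their
smallest elements, the sets of `I` and `lam` together forming a set composition of `{1, …, n}`, and
each word being a prime parking function of the length of its set. -/
@[ext] structure RBiWord (r : ℕ∞) (n : ℕ) where
  I : List BiColumn
  lam : List BiColumn
  prime' : ∀ c ∈ I ++ lam, IsPrimeParking c.2
  length' : ∀ c ∈ I ++ lam, c.2.length = c.1.card
  le_card' : ∀ c ∈ I, r ≤ (c.1.card : ℕ∞)
  card_lt' : ∀ c ∈ lam, (c.1.card : ℕ∞) < r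
  sorted' : lam.Pairwise fun c d => c.1.min < d.1.min
  nonempty' : ∀ c ∈ I ++ lam, c.1.Nonempty
  disjoint' : (I ++ lam).Pairwise fun c d => Disjoint c.1 d.1
  cover' : ∀ x, (∃ c ∈ I ++ lam, x ∈ c.1) ↔ x ∈ Finset.Icc 1 n

namespace RBiWord

variable {r : ℕ∞} {n : ℕ}

/-- The number of (nonempty) columns. -/
def numCols (u : RBiWord r n) : ℕ := (u.I ++ u.lam).length

/-- The bi-word obtained by concatenating `I` and `lam` and adding empty columns to the right. -/
def toBiWord (u : RBiWord r n) : BiWord n where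
  col i := (u.I ++ u.lam).getD i (∅, [])
  disjoint' i j hij := by
    rcases lt_or_ge i (u.I ++ u.lam).length with hi | hi
    · rcases lt_or_ge j (u.I ++ u.lam).length with hj | hj
      · rw [List.getD_eq_getElem _ _ hi, List.getD_eq_getElem _ _ hj]
        rcases lt_or_gt_of_ne hij with h | h
        · exact List.pairwise_iff_getElem.1 u.disjoint' i j hi hj h
        · exact (List.pairwise_iff_getElem.1 u.disjoint' j i hj hi h).symm
      · rw [List.getD_eq_default (l := u.I ++ u.lam) (n := j) _ hj]
        exact Finset.disjoint_empty_right _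
    · rw [List.getD_eq_default (l := u.I ++ u.lam) (n := i) _ hi]
      exact Finset.disjoint_empty_left _
  cover' x := by
    rw [← u.cover' x]
    constructor
    · rintro ⟨i, hi⟩
      rcases lt_or_ge i (u.I ++ u.lam).length with h | h
      · rw [List.getD_eq_getElem _ _ h] at hi
        exact ⟨_, List.getElem_mem h, hi⟩
      · rw [List.getD_eq_default (l := u.I ++ u.lam) (n := i) _ h] at hi
        simp at hi
    · rintro ⟨c, hc, hx⟩
      obtain ⟨i, hi, rfl⟩ := List.getElem_of_mem hc
      exact ⟨i, by rwa [List.getD_eq_getElem _ _ hi]⟩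
  prime' i := by
    rcases lt_or_ge i (u.I ++ u.lam).length with h | h
    · rw [List.getD_eq_getElem _ _ h]
      exact u.prime' _ (List.getElem_mem h)
    · rw [List.getD_eq_default (l := u.I ++ u.lam) (n := i) _ h]
      simp [IsPrimeParking, IsParking, PosWord.rearr]
  length' i := by
    rcases lt_or_ge i (u.I ++ u.lam).length with h | h
    · rw [List.getD_eq_getElem _ _ h]
      exact u.length' _ (List.getElem_mem h)
    · rw [List.getD_eq_default (l := u.I ++ u.lam) (n := i) _ h]
      simp

/-- The vector `G_u^{(r)} = ∑ w`, the sum over the words `w` encoded by the bi-words in the orbit of `u`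
under the `r`-action. A formal (infinite) sum of words with coefficients in `K` is represented by
its coefficient function; the sum of the words of a set is the indicator function of that set. -/
noncomputable def G (K : Type*) [Field K] (u : RBiWord r n) : PosWord → K :=
  (BiWord.toWord '' BiWord.orbit r u.toBiWord).indicator fun _ => 1

end RBiWord

/-- The set of the vectors `G_u^{(r)}`, where `u` is an `r`-bi-word of length `n` with `k` nonempty
columns. -/
def GVectors (K : Type*) [Field K] (r : ℕ∞) (n k : ℕ) : Set (PosWord → K) :=
  {g | ∃ u : RBiWord r n, u.numCols = k ∧ u.G K = g}

/-- `A_{n,k}^r`: the sum over the partitions `{Q₁, …, Q_k}` of `{1, …, n}` into `k` parts of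
`#{i : |Qᵢ| ≥ r}! ∏ᵢ (|Qᵢ| - 1)^(|Qᵢ| - 1)`, with `0 ^ 0 = 1`. -/
noncomputable def ACoeff (r : ℕ∞) (n k : ℕ) : ℕ :=
  open Classical in
  ∑ Q : Finpartition (Finset.Icc 1 n) with Q.parts.card = k,
    (Q.parts.filter fun q => r ≤ (q.card : ℕ∞)).card ! *
      ∏ q ∈ Q.parts, (q.card - 1) ^ (q.card - 1)

/-! ### Rooted labeled trees -/

/-- A rooted (non-planar) tree whose set of labels (= vertices) is `V`. -/
structure LabeledRootedTree (V : Type*) where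
  graph : SimpleGraph V
  isTree : graph.IsTree
  root : V

namespace LabeledRootedTree

variable {V : Type*} [LinearOrder V]

/-- The vertices of the maximal decreasing subtree `MD(T)`: those to which the path from the root is
decreasing. -/
def mdVerts (T : LabeledRootedTree V) : Set V :=
  {v | ∃ p : T.graph.Path T.root v, (p : T.graph.Walk T.root v).support.Pairwise (· > ·)}

/-- `c` is a child of `v`: it is a neighbour one step further from the root. -/
def IsChild (T : LabeledRootedTree V) (v c : V) : Prop :=
  T.graph.Adj v c ∧ T.graph.dist T.root c = T.graph.dist T.root v + 1

/-- The maximal decreasing subtree is a chain: each of its vertices has at most one child in it. -/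
def MDIsChain (T : LabeledRootedTree V) : Prop :=
  ∀ v ∈ T.mdVerts, ∀ a ∈ T.mdVerts, ∀ b ∈ T.mdVerts, T.IsChild v a → T.IsChild v b → a = b

end LabeledRootedTree

/-- `T_{n,k}`: the rooted labeled trees on `n + 1` totally ordered labels whose maximal decreasing
subtree has `k + 1` vertices. -/
def treesMD (n k : ℕ) : Set (LabeledRootedTree (Fin (n + 1))) :=
  {T | T.mdVerts.ncard = k + 1}

/-- `T'_{n,k}`: the rooted labeled trees on `n` totally ordered labels whose maximal decreasing subtree
is a chain with `k` vertices. -/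
def treesMDChain (n k : ℕ) : Set (LabeledRootedTree (Fin n)) :=
  {T | T.MDIsChain ∧ T.mdVerts.ncard = k}

/-!
Everything is compared with the numbers `A n k = ACoeff ⊤ n k`, the sums over the partitions of an
`n`-set into `k` blocks of the products of the `(|Q| - 1) ^ (|Q| - 1)`. Splitting off the block that
contains a fixed element shows that they satisfy
`A (n + 1) (k + 1) = ∑ z, (n choose z) * z ^ z * A (n - z) k`
(`satisfiesBlockRecursion_ACoeff_top`). This recursion is solved by Abel's identity: by induction on
`k`, `k! * A n k` is an alternating sum of values of Abel's polynomials at `0, -1, …, -k`, and hence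
`k! * A (n + 1) (k + 1) = ∑ (-1)^i (k choose i) (n - i)^n`
(`SatisfiesBlockRecursion.factorial_mul_succ_succ`). The formula with Stirling numbers is a binomial
expansion of the same sum (`sum_choose_mul_stirlingSecond`).

Trees. A rooted tree is encoded by its parent function `V → Option V`. Cutting off the maximal
decreasing subtree leaves a forest whose `k` roots, the vertices of that subtree, are smaller than
their children, and the decreasing subtree can be put back in `(k - 1)!` ways, or in one way if it has
to be a chain (`ncard_eq_of_forall_mem_iff`, `card_decreasingTrees`, `card_decreasingChains`). So it
remains to see that such forests are counted by `A n k` (`card_smallRootForests`). All functions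
`p : V → Option V` with `k` values `none` such that the points with value `none` are smaller than their
preimages are counted in two ways. Directly, their number times `k!` is the alternating sum above, by
induction on the largest point, so they are `A (n + 1) (k + 1)` many. On the other hand, the set `Z` of
the points which never reach a root carries an arbitrary endofunction, and off `Z` the function is a
forest; so the forests satisfy the relation which the recursion for `A (n + 1) (k + 1)` expresses, and
induction on `n` gives equality.

Bi-words. There are `(m - 1) ^ (m - 1)` prime parking functions of length `m` (`card_primeWords`): a
word of length `n` in the letters `1, …, n` which has a letter `1` is determined by its first block, a
prime parking function, and by larger letters elsewhere, and the resulting recursion for the numbers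
of prime parking functions is Abel's identity at `-1`. The same notion of first block recovers the
columns of a bi-word from its word (`BiWord.toWord_injective`). As the `∞`-action permutes the columns,
the vector of `u` determines the set of columns of `u` and hence `u` (`RBiWord.G_injective`), and the
`∞`-bi-words with `k` columns are counted by `A n k` (`RBiWord.card_numCols_eq`).
-/

/-! ### Abel's identity and alternating sums -/

/-- Abel's polynomial `α (α + m) ^ (m - 1)`, read as `1` for `m = 0`. -/
def abelVal (α : ℚ) : ℕ → ℚ
  | 0 => 1
  | m + 1 => α * (α + (m + 1)) ^ m

section AbelPolynomial

open Polynomial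

/-- Abel's polynomial `X (X + m) ^ (m - 1)`, read as `1` for `m = 0`. -/
noncomputable def abelPoly : ℕ → ℚ[X]
  | 0 => 1
  | m + 1 => X * (X + C ((m : ℚ) + 1)) ^ m

theorem eval_abelPoly (α : ℚ) (m : ℕ) : (abelPoly m).eval α = abelVal α m := by
  cases m <;> simp [abelPoly, abelVal]

theorem derivative_abelPoly_succ (m : ℕ) :
    derivative (abelPoly (m + 1)) = C ((m : ℚ) + 1) * (abelPoly m).comp (X + 1) := by
  cases m with
  | zero => simp [abelPoly]
  | succ m =>
    simp only [abelPoly, derivative_mul, derivative_X, derivative_pow, derivative_add,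
      derivative_C, mul_comp, X_comp, pow_comp, add_comp, C_comp]
    simp only [map_add, map_natCast, map_one, Nat.cast_add, Nat.cast_one, Nat.add_sub_cancel]
    ring

theorem eq_of_derivative_eq {p q : ℚ[X]} (h : derivative p = derivative q)
    (h0 : p.eval 0 = q.eval 0) : p = q := by
  have h1 : derivative (p - q) = 0 := by simp [h]
  have h2 := derivative_eq_zero.1 h1
  rw [natDegree_eq_zero] at h2
  obtain ⟨c, hc⟩ := h2
  have h3 : c = 0 := by
    have := congrArg (eval 0) hc
    simpa [h0] using this
  rw [h3, C_0] at hc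
  exact sub_eq_zero.1 hc.symm

/-- Abel's identity as an identity of polynomials: both sides have the same value at `0`, and the
derivatives of both sides at `n + 1` are the two sides at `n`, shifted by `1` and multiplied by
`n + 1`. -/
theorem sum_choose_mul_abelPoly (n : ℕ) :
    ∑ j ∈ Finset.range (n + 1), C ((n.choose j : ℚ) * (j : ℚ) ^ j) * abelPoly (n - j) =
      (X + C (n : ℚ)) ^ n := by
  induction n with
  | zero => simp [abelPoly]
  | succ n ih =>
    apply eq_of_derivative_eq
    · rw [Finset.sum_range_succ]
      have h1 : ∀ j ∈ Finset.range (n + 1),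
          C (((n + 1).choose j : ℚ) * (j : ℚ) ^ j) * abelPoly (n + 1 - j) =
            C (((n + 1).choose j : ℚ) * (j : ℚ) ^ j) * abelPoly ((n - j) + 1) := by
        intro j hj
        rw [Finset.mem_range] at hj
        congr 2
        omega
      have h2 : ∀ j ∈ Finset.range (n + 1),
          derivative (C (((n + 1).choose j : ℚ) * (j : ℚ) ^ j) * abelPoly ((n - j) + 1)) =
            C ((n : ℚ) + 1) *
              (C ((n.choose j : ℚ) * (j : ℚ) ^ j) * abelPoly (n - j)).comp (X + 1) := by
        intro j hj
        rw [Finset.mem_range] at hj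
        rw [derivative_C_mul, derivative_abelPoly_succ, mul_comp, C_comp, ← mul_assoc, ← mul_assoc,
          ← C_mul, ← C_mul]
        congr 2
        have h3 : ((n + 1).choose j : ℚ) * ((n + 1 - j : ℕ) : ℚ) = (n + 1) * n.choose j := by
          have h4 := Nat.choose_mul_succ_eq n j
          exact_mod_cast (by rw [← h4]; ring : (n + 1).choose j * (n + 1 - j) = (n + 1) * n.choose j)
        have h4 : (((n - j : ℕ) : ℚ) + 1) = ((n + 1 - j : ℕ) : ℚ) := by
          rw [show n + 1 - j = (n - j) + 1 by omega]
          push_cast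
          ring
        rw [h4]
        linear_combination (j : ℚ) ^ j * h3
      rw [Finset.sum_congr rfl h1, derivative_add, derivative_sum, Finset.sum_congr rfl h2,
        ← Finset.mul_sum, ← Polynomial.sum_comp, ih]
      simp only [Nat.sub_self, abelPoly, mul_one, derivative_C, add_zero, pow_comp, add_comp,
        X_comp, C_comp, derivative_pow, derivative_add, derivative_X, Nat.add_sub_cancel]
      simp only [map_add, map_natCast, map_one, Nat.cast_add, Nat.cast_one]
      ring
    · rw [Finset.sum_range_succ, eval_add, eval_finsetSum, Finset.sum_eq_zero]
      · simp [abelPoly]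
      · intro j hj
        rw [Finset.mem_range] at hj
        rw [show n + 1 - j = (n - j) + 1 by omega]
        simp [abelPoly]

end AbelPolynomial

/-- Abel's identity. -/
theorem sum_choose_mul_abelVal (α : ℚ) (n : ℕ) :
    ∑ j ∈ Finset.range (n + 1), (n.choose j : ℚ) * (j : ℚ) ^ j * abelVal α (n - j) =
      (α + n) ^ n := by
  have h := congrArg (Polynomial.eval α) (sum_choose_mul_abelPoly n)
  simpa [Polynomial.eval_finsetSum, eval_abelPoly] using h

/-- The alternating sum `∑ (-1)^i (K choose i) (y - i)^N`. -/
def altSum (N K : ℕ) (y : ℚ) : ℚ :=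
  ∑ i ∈ Finset.range (K + 1), (-1 : ℚ) ^ i * (K.choose i : ℚ) * (y - i) ^ N

/-- The absorption `i (K + 1 choose i) = (K + 1) (K choose i - 1)` under an alternating sum. -/
theorem sum_alternating_choose_mul_index (K : ℕ) (F : ℕ → ℚ) :
    ∑ i ∈ Finset.range (K + 2), (-1 : ℚ) ^ i * ((K + 1).choose i : ℚ) * ((i : ℚ) * F i) =
      -((K : ℚ) + 1) * ∑ i ∈ Finset.range (K + 1), (-1 : ℚ) ^ i * (K.choose i : ℚ) * F (i + 1) := by
  rw [Finset.sum_range_succ', Finset.mul_sum]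
  simp only [Nat.cast_zero, zero_mul, mul_zero, add_zero]
  refine Finset.sum_congr rfl fun i _ => ?_
  have h : ((K : ℚ) + 1) * (K.choose i : ℚ) = ((K + 1).choose (i + 1) : ℚ) * (i + 1) := by
    exact_mod_cast Nat.add_one_mul_choose_eq K i
  push_cast
  rw [pow_succ]
  linear_combination (-1 : ℚ) ^ i * F (i + 1) * h

theorem altSum_zero_right (N : ℕ) (y : ℚ) : altSum N 0 y = y ^ N := by
  simp [altSum]

theorem altSum_zero_left (K : ℕ) (y : ℚ) : altSum 0 (K + 1) y = 0 := by
  have h := Int.alternating_sum_range_choose_of_ne (n := K + 1) (by omega)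
  have h2 := congrArg (Int.cast : ℤ → ℚ) h
  push_cast at h2
  simpa [altSum] using h2

theorem altSum_succ_succ (N K : ℕ) (y : ℚ) :
    altSum (N + 1) (K + 1) y = y * altSum N (K + 1) y + (K + 1) * altSum N K (y - 1) := by
  have h := sum_alternating_choose_mul_index K fun i => (y - i) ^ N
  have h1 : altSum N K (y - 1) =
      ∑ i ∈ Finset.range (K + 1), (-1 : ℚ) ^ i * (K.choose i : ℚ) * (y - (i + 1 : ℕ)) ^ N := by
    refine Finset.sum_congr rfl fun i _ => ?_
    push_cast
    ring
  rw [h1]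
  have h2 : altSum (N + 1) (K + 1) y = y * altSum N (K + 1) y -
      ∑ i ∈ Finset.range (K + 2), (-1 : ℚ) ^ i * ((K + 1).choose i : ℚ) * ((i : ℚ) * (y - i) ^ N) := by
    rw [altSum, altSum, Finset.mul_sum, ← Finset.sum_sub_distrib]
    refine Finset.sum_congr rfl fun i _ => ?_
    ring
  rw [h2, h]
  ring

theorem factorial_mul_stirlingSecond (N K : ℕ) :
    (K ! : ℚ) * (Nat.stirlingSecond N K : ℚ) = altSum N K K := by
  induction N generalizing K with
  | zero =>
    cases K with
    | zero => simp [altSum]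
    | succ K => simp [altSum_zero_left]
  | succ N ih =>
    cases K with
    | zero => simp [altSum]
    | succ K =>
      rw [altSum_succ_succ, Nat.stirlingSecond_succ_succ]
      have h1 := ih (K + 1)
      have h2 := ih K
      push_cast [Nat.factorial_succ] at h1 ⊢
      rw [add_sub_cancel_right, ← h1, ← h2]
      ring

theorem sum_choose_mul_stirlingSecond (n k : ℕ) :
    ∑ m ∈ Finset.Icc k n,
        (n.choose m : ℚ) * (Nat.stirlingSecond m k : ℚ) * ((n : ℚ) - (k : ℚ)) ^ (n - m) =
      1 / (k ! : ℚ) * altSum n k n := by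
  have h0 : (k ! : ℚ) ≠ 0 := by exact_mod_cast Nat.factorial_ne_zero k
  have h1 : ∑ m ∈ Finset.Icc k n,
        (n.choose m : ℚ) * (Nat.stirlingSecond m k : ℚ) * ((n : ℚ) - (k : ℚ)) ^ (n - m) =
      ∑ m ∈ Finset.range (n + 1),
        (n.choose m : ℚ) * (Nat.stirlingSecond m k : ℚ) * ((n : ℚ) - (k : ℚ)) ^ (n - m) := by
    apply Finset.sum_subset
    · intro m hm
      simp only [Finset.mem_Icc, Finset.mem_range] at hm ⊢
      omega
    · intro m hm hm'
      simp only [Finset.mem_Icc, Finset.mem_range] at hm hm'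
      rw [Nat.stirlingSecond_eq_zero_of_lt (by omega)]
      simp
  rw [h1, eq_comm, one_div, inv_mul_eq_iff_eq_mul₀ h0, Finset.mul_sum]
  have h2 : ∀ m ∈ Finset.range (n + 1), (k ! : ℚ) *
      ((n.choose m : ℚ) * (Nat.stirlingSecond m k : ℚ) * ((n : ℚ) - (k : ℚ)) ^ (n - m)) =
      ∑ i ∈ Finset.range (k + 1), (-1 : ℚ) ^ i * (k.choose i : ℚ) *
        (((k : ℚ) - i) ^ m * ((n : ℚ) - k) ^ (n - m) * (n.choose m : ℚ)) := by
    intro m _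
    have h3 := factorial_mul_stirlingSecond m k
    rw [show (k ! : ℚ) * ((n.choose m : ℚ) * (Nat.stirlingSecond m k : ℚ) *
      ((n : ℚ) - (k : ℚ)) ^ (n - m)) = ((k ! : ℚ) * (Nat.stirlingSecond m k : ℚ)) *
      ((n.choose m : ℚ) * ((n : ℚ) - (k : ℚ)) ^ (n - m)) by ring, h3, altSum, Finset.sum_mul]
    refine Finset.sum_congr rfl fun i _ => ?_
    ring
  rw [Finset.sum_congr rfl h2, Finset.sum_comm, altSum]
  refine Finset.sum_congr rfl fun i _ => ?_
  rw [← Finset.mul_sum, ← add_pow]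
  congr 2
  ring

/-- The recursion of the numbers `A_{n,k}`, where the summand `z` accounts for the blocks of size
`z + 1` containing a fixed element, together with its initial values. -/
structure SatisfiesBlockRecursion (A : ℕ → ℕ → ℕ) : Prop where
  zero_zero : A 0 0 = 1
  succ_zero : ∀ n, A (n + 1) 0 = 0
  zero_succ : ∀ k, A 0 (k + 1) = 0
  succ_succ : ∀ n k, A (n + 1) (k + 1) =
    ∑ z ∈ Finset.range (n + 1), n.choose z * z ^ z * A (n - z) k

namespace SatisfiesBlockRecursion

variable {A : ℕ → ℕ → ℕ}

theorem eq_zero_of_lt (hA : SatisfiesBlockRecursion A) {n k : ℕ} (h : n < k) : A n k = 0 := by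
  induction k generalizing n with
  | zero => omega
  | succ k ih =>
    cases n with
    | zero => exact hA.zero_succ k
    | succ n =>
      rw [hA.succ_succ]
      exact Finset.sum_eq_zero fun z _ => by rw [ih (by omega), mul_zero]

theorem factorial_mul_succ_succ_of_eq (hA : SatisfiesBlockRecursion A) {k : ℕ}
    (h : ∀ n, (k ! : ℚ) * A n k =
      ∑ i ∈ Finset.range (k + 1), (-1 : ℚ) ^ i * (k.choose i : ℚ) * abelVal (-(i : ℚ)) n) (n : ℕ) :
    (k ! : ℚ) * A (n + 1) (k + 1) = altSum n k n := by
  rw [hA.succ_succ]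
  push_cast
  rw [Finset.mul_sum]
  have h2 : ∀ z ∈ Finset.range (n + 1),
      (k ! : ℚ) * ((n.choose z : ℚ) * (z : ℚ) ^ z * (A (n - z) k : ℚ)) =
      ∑ i ∈ Finset.range (k + 1), (-1 : ℚ) ^ i * (k.choose i : ℚ) *
        ((n.choose z : ℚ) * (z : ℚ) ^ z * abelVal (-(i : ℚ)) (n - z)) := by
    intro z _
    rw [show (k ! : ℚ) * ((n.choose z : ℚ) * (z : ℚ) ^ z * (A (n - z) k : ℚ)) =
      ((k ! : ℚ) * A (n - z) k) * ((n.choose z : ℚ) * (z : ℚ) ^ z) by ring, h, Finset.sum_mul]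
    exact Finset.sum_congr rfl fun i _ => by ring
  rw [Finset.sum_congr rfl h2, Finset.sum_comm]
  refine Finset.sum_congr rfl fun i _ => ?_
  rw [← Finset.mul_sum, sum_choose_mul_abelVal]
  ring

/-- The numbers with the block recursion are alternating sums of values of Abel's polynomials at
nonpositive integers; Abel's identity evaluates the sum in the recursion. -/
theorem factorial_mul_eq_sum_abelVal (hA : SatisfiesBlockRecursion A) (n k : ℕ) :
    (k ! : ℚ) * A n k =
      ∑ i ∈ Finset.range (k + 1), (-1 : ℚ) ^ i * (k.choose i : ℚ) * abelVal (-(i : ℚ)) n := by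
  induction k generalizing n with
  | zero =>
    cases n with
    | zero => simp [hA.zero_zero, abelVal]
    | succ n => simp [hA.succ_zero, abelVal]
  | succ k ih =>
    cases n with
    | zero =>
      have h := altSum_zero_left k 0
      simp only [altSum, pow_zero, mul_one] at h
      simp [hA.zero_succ, abelVal, h]
    | succ n =>
      have h1 := sum_alternating_choose_mul_index k fun i => (-((-(i : ℚ)) + (n + 1)) ^ n)
      simp only [abelVal]
      rw [show ∑ i ∈ Finset.range (k + 1 + 1), (-1 : ℚ) ^ i * ((k + 1).choose i : ℚ) *
        (-(i : ℚ) * (-(i : ℚ) + (n + 1)) ^ n) = ∑ i ∈ Finset.range (k + 2), (-1 : ℚ) ^ i *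
          ((k + 1).choose i : ℚ) * ((i : ℚ) * -((-(i : ℚ)) + (n + 1)) ^ n) from
        Finset.sum_congr rfl fun i _ => by ring, h1, Nat.factorial_succ]
      push_cast
      rw [mul_assoc, hA.factorial_mul_succ_succ_of_eq ih, neg_mul, ← mul_neg,
        ← Finset.sum_neg_distrib, altSum]
      congr 1
      refine Finset.sum_congr rfl fun i _ => ?_
      ring

theorem factorial_mul_succ_succ (hA : SatisfiesBlockRecursion A) (n k : ℕ) :
    (k ! : ℚ) * A (n + 1) (k + 1) = altSum n k n :=
  hA.factorial_mul_succ_succ_of_eq (fun m => hA.factorial_mul_eq_sum_abelVal m k) n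

end SatisfiesBlockRecursion

/-! ### Sums over set partitions -/

section Partitions

variable {α : Type*} [DecidableEq α]

/-- The sum over the partitions of `s` into `k` parts of the product of the weights `g |q|` of the
parts `q`. -/
def partitionSum (g : ℕ → ℕ) (s : Finset α) (k : ℕ) : ℕ :=
  ∑ Q : Finpartition s with Q.parts.card = k, ∏ q ∈ Q.parts, g q.card

theorem partitionSum_empty (g : ℕ → ℕ) (k : ℕ) :
    partitionSum g (∅ : Finset α) k = if k = 0 then 1 else 0 := by
  have h : ∀ Q : Finpartition (∅ : Finset α), Q.parts = ∅ := fun Q =>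
    Q.parts_eq_empty_iff.2 rfl
  have hu : (Finset.univ : Finset (Finpartition (∅ : Finset α))) = {Finpartition.empty _} :=
    Finset.eq_singleton_iff_unique_mem.2 ⟨Finset.mem_univ _, fun Q _ =>
      Finpartition.ext (by rw [h, h])⟩
  rw [partitionSum, Finset.sum_filter, hu, Finset.sum_singleton, h]
  simp [eq_comm]

theorem partitionSum_zero_right (g : ℕ → ℕ) {s : Finset α} (hs : s.Nonempty) :
    partitionSum g s 0 = 0 := by
  rw [partitionSum, Finset.sum_eq_zero]
  intro Q hQ
  rw [Finset.mem_filter, Finset.card_eq_zero, Finpartition.parts_eq_empty_iff] at hQ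
  exact absurd hQ.2 hs.ne_empty

/-- Removing a part. -/
def Finpartition.removePart {s : Finset α} (Q : Finpartition s) (b t : Finset α) (hb : b ∈ Q.parts)
    (ht : t = s \ b) : Finpartition t where
  parts := Q.parts.erase b
  supIndep := Q.supIndep.subset (Finset.erase_subset _ _)
  sup_parts := by
    subst ht
    ext x
    simp only [Finset.mem_sup, Finset.mem_erase, id, Finset.mem_sdiff]
    constructor
    · rintro ⟨q, ⟨hqb, hq⟩, hx⟩
      exact ⟨Q.subset hq hx, fun hxb => hqb (Q.eq_of_mem_parts hq hb hx hxb)⟩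
    · rintro ⟨hx, hxb⟩
      obtain ⟨q, hq, hxq⟩ := Q.exists_mem hx
      exact ⟨q, ⟨fun h => hxb (h ▸ hxq), hq⟩, hxq⟩
  bot_notMem h := Q.bot_notMem (Finset.mem_of_mem_erase h)

theorem sum_finpartition_with_part (g : ℕ → ℕ) {s b t : Finset α} {a : α} (hab : a ∈ b)
    (hbs : b ⊆ s) (ht : t = s \ b) (k : ℕ) :
    ∑ Q : Finpartition s with Q.parts.card = k + 1 ∧ b ∈ Q.parts, ∏ q ∈ Q.parts, g q.card =
      g b.card * partitionSum g t k := by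
  have hb : b ≠ ⊥ := Finset.ne_empty_of_mem hab
  have hd : Disjoint t b := ht ▸ Finset.sdiff_disjoint
  have hc : t ⊔ b = s := ht ▸ Finset.sdiff_union_of_subset hbs
  have hnot : ∀ Q : Finpartition t, b ∉ Q.parts := fun Q h => by
    have h1 := Q.subset h hab
    exact Finset.disjoint_left.1 hd h1 hab
  rw [partitionSum, Finset.mul_sum, eq_comm]
  refine Finset.sum_bij (fun Q _ => Q.extend hb hd hc) ?_ ?_ ?_ ?_
  · intro Q hQ
    rw [Finset.mem_filter] at hQ
    simp only [Finset.mem_filter, Finset.mem_univ, true_and, Finpartition.extend]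
    exact ⟨by rw [Finset.card_insert_of_notMem (hnot Q), hQ.2], Finset.mem_insert_self _ _⟩
  · intro Q _ Q' _ h
    have h1 := congrArg (fun P => P.parts.erase b) h
    simp only [Finpartition.extend, Finset.erase_insert (hnot _)] at h1
    exact Finpartition.ext h1
  · intro Q hQ
    simp only [Finset.mem_filter, Finset.mem_univ, true_and] at hQ
    refine ⟨Q.removePart b t hQ.2 ht, ?_, ?_⟩
    · simp [Finpartition.removePart, Finset.card_erase_of_mem hQ.2, hQ.1]
    · apply Finpartition.ext
      simp [Finpartition.removePart, Finpartition.extend, Finset.insert_erase hQ.2]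
  · intro Q _
    simp only [Finpartition.extend]
    rw [Finset.prod_insert (hnot Q)]

/-- The summand of `Z` is the sum over the partitions with the part `insert a Z`. -/
theorem partitionSum_insert (g : ℕ → ℕ) {s : Finset α} {a : α} (ha : a ∉ s) (k : ℕ) :
    partitionSum g (insert a s) (k + 1) =
      ∑ Z ∈ s.powerset, g (Z.card + 1) * partitionSum g (s \ Z) k := by
  have hmem : ∀ Q : Finpartition (insert a s), a ∈ Q.part a := fun Q =>
    Q.mem_part_self.2 (Finset.mem_insert_self _ _)
  rw [partitionSum, ← Finset.sum_fiberwise_of_maps_to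
    (g := fun Q : Finpartition (insert a s) => (Q.part a).erase a) (t := s.powerset)]
  · refine Finset.sum_congr rfl fun Z hZ => ?_
    rw [Finset.mem_powerset] at hZ
    have haZ : a ∉ Z := fun h => ha (hZ h)
    rw [← Finset.card_insert_of_notMem haZ, ← sum_finpartition_with_part g
      (s := insert a s) (b := insert a Z) (t := s \ Z) (Finset.mem_insert_self a Z)
      (Finset.insert_subset_insert _ hZ) (by
        ext x
        simp only [Finset.mem_sdiff, Finset.mem_insert]
        constructor
        · rintro ⟨h1, h2⟩
          exact ⟨Or.inr h1, fun h => h.elim (fun h => ha (h ▸ h1)) h2⟩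
        · rintro ⟨h1, h2⟩
          exact ⟨h1.resolve_left fun h => h2 (Or.inl h), fun h => h2 (Or.inr h)⟩)]
    rw [Finset.filter_filter]
    refine Finset.sum_congr (Finset.filter_congr fun Q _ => and_congr_right fun _ => ?_) fun _ _ => rfl
    constructor
    · rintro rfl
      rw [Finset.insert_erase (hmem Q)]
      exact Q.part_mem.2 (Finset.mem_insert_self _ _)
    · intro h
      rw [Q.part_eq_of_mem h (Finset.mem_insert_self _ _), Finset.erase_insert haZ]
  · intro Q _
    rw [Finset.mem_powerset, ← Finset.subset_insert_iff]
    exact Q.part_subset a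

end Partitions

theorem partitionSum_insert_eq_sum_range (g : ℕ → ℕ) {s : Finset ℕ} {a : ℕ} (ha : a ∉ s) (k : ℕ)
    (h : ∀ t ⊆ s, partitionSum g t k = partitionSum g (Finset.Icc 1 t.card) k) :
    partitionSum g (insert a s) (k + 1) =
      ∑ z ∈ Finset.range (s.card + 1),
        s.card.choose z * g (z + 1) * partitionSum g (Finset.Icc 1 (s.card - z)) k := by
  have h1 := Finset.sum_powerset_apply_card (x := s)
    (fun z => g (z + 1) * partitionSum g (Finset.Icc 1 (s.card - z)) k)
  simp only [smul_eq_mul, ← mul_assoc] at h1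
  rw [partitionSum_insert g ha, ← h1]
  refine Finset.sum_congr rfl fun Z hZ => ?_
  rw [h _ Finset.sdiff_subset, Finset.card_sdiff_of_subset (Finset.mem_powerset.1 hZ)]

theorem partitionSum_eq_partitionSum_Icc (g : ℕ → ℕ) (s : Finset ℕ) (k : ℕ) :
    partitionSum g s k = partitionSum g (Finset.Icc 1 s.card) k := by
  induction k generalizing s with
  | zero =>
    rcases s.eq_empty_or_nonempty with rfl | hs
    · rfl
    · rw [partitionSum_zero_right g hs, partitionSum_zero_right g]
      exact Finset.nonempty_Icc.2 (Finset.card_pos.2 hs)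
  | succ k ih =>
    rcases s.eq_empty_or_nonempty with rfl | ⟨a, ha⟩
    · rfl
    · obtain ⟨t, hat, rfl⟩ : ∃ t, a ∉ t ∧ insert a t = s :=
        ⟨s.erase a, Finset.notMem_erase a s, Finset.insert_erase ha⟩
      rw [Finset.card_insert_of_notMem hat, ← Finset.insert_Icc_right_eq_Icc_add_one (by omega),
        partitionSum_insert_eq_sum_range g hat k fun t _ => ih t,
        partitionSum_insert_eq_sum_range g (by simp) k fun t _ => ih t, Nat.card_Icc,
        Nat.add_sub_cancel]

/-- The numbers `A_{n,k}` in the absence of columns of size at least `r`. -/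
theorem ACoeff_top_eq_partitionSum (n k : ℕ) :
    ACoeff ⊤ n k = partitionSum (fun m => (m - 1) ^ (m - 1)) (Finset.Icc 1 n) k := by
  unfold ACoeff partitionSum
  refine Finset.sum_congr (by ext; simp) fun Q _ => ?_
  rw [Finset.filter_false_of_mem, Finset.card_empty, Nat.factorial_zero, one_mul]
  intro q _
  simp

theorem satisfiesBlockRecursion_ACoeff_top : SatisfiesBlockRecursion (ACoeff ⊤) where
  zero_zero := by
    rw [ACoeff_top_eq_partitionSum, show Finset.Icc 1 0 = ∅ from rfl, partitionSum_empty, if_pos rfl]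
  succ_zero n := by
    rw [ACoeff_top_eq_partitionSum, partitionSum_zero_right]
    exact Finset.nonempty_Icc.2 (by omega)
  zero_succ k := by
    rw [ACoeff_top_eq_partitionSum, show Finset.Icc 1 0 = ∅ from rfl, partitionSum_empty,
      if_neg k.succ_ne_zero]
  succ_succ n k := by
    rw [ACoeff_top_eq_partitionSum, ← Finset.insert_Icc_right_eq_Icc_add_one (by omega),
      partitionSum_insert_eq_sum_range _ (by simp) k fun t _ =>
        partitionSum_eq_partitionSum_Icc _ t k, Nat.card_Icc, Nat.add_sub_cancel]
    refine Finset.sum_congr rfl fun z _ => ?_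
    rw [ACoeff_top_eq_partitionSum, Nat.add_sub_cancel]

/-! ### Forests whose roots are smaller than their children -/

section InsertionSum

variable {α : Type*} [LinearOrder α]

/-- Choosing `K` elements `D` of `s` and, for each other element `v`, one of `t + #{d ∈ D | d < v}`
values gives an alternating sum; induction on the largest element of `s`. -/
theorem factorial_mul_sum_powersetCard_prod (s : Finset α) (K t : ℕ) :
    (K ! : ℚ) * ((∑ D ∈ s.powersetCard K, ∏ v ∈ s \ D, (t + (D.filter (· < v)).card) : ℕ) : ℚ) =
      altSum s.card K (t + K) := by
  induction s using Finset.induction_on_max generalizing K with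
  | empty =>
    cases K with
    | zero => simp [altSum]
    | succ K =>
      rw [Finset.card_empty, altSum_zero_left, Finset.powersetCard_eq_empty.2 (by simp)]
      simp
  | insert a s ha ih =>
    have has : a ∉ s := fun h => lt_irrefl a (ha a h)
    cases K with
    | zero => simp [altSum_zero_right]
    | succ K =>
      rw [Finset.card_insert_of_notMem has, altSum_succ_succ, Finset.powersetCard_succ_insert has,
        Finset.sum_union, Finset.sum_image]
      · have h1 : ∀ D ∈ s.powersetCard (K + 1),
            ∏ v ∈ insert a s \ D, (t + (D.filter (· < v)).card) =
              (t + (K + 1)) * ∏ v ∈ s \ D, (t + (D.filter (· < v)).card) := by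
          intro D hD
          rw [Finset.mem_powersetCard] at hD
          have haD : a ∉ D := fun h => has (hD.1 h)
          rw [Finset.insert_sdiff_of_notMem _ haD, Finset.prod_insert (by simp [has]),
            Finset.filter_true_of_mem fun d hd => ha d (hD.1 hd), hD.2]
        have h2 : ∀ D ∈ s.powersetCard K,
            ∏ v ∈ insert a s \ insert a D, (t + ((insert a D).filter (· < v)).card) =
              ∏ v ∈ s \ D, (t + (D.filter (· < v)).card) := by
          intro D hD
          rw [Finset.mem_powersetCard] at hD
          rw [Finset.insert_sdiff_insert, Finset.sdiff_insert_of_notMem has]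
          refine Finset.prod_congr rfl fun v hv => ?_
          rw [Finset.mem_sdiff] at hv
          rw [Finset.filter_insert, if_neg (ha v hv.1).not_gt]
        rw [Finset.sum_congr rfl h1, Finset.sum_congr rfl h2, ← Finset.mul_sum]
        have i1 := ih (K + 1)
        have i2 := ih K
        rw [Nat.factorial_succ] at i1 ⊢
        push_cast at i1 i2 ⊢
        rw [show (t : ℚ) + (K + 1) - 1 = t + K by ring, ← i1, ← i2]
        ring
      · intro D hD D' hD' h
        have hD1 := (Finset.mem_powersetCard.1 hD).1
        have hD2 := (Finset.mem_powersetCard.1 hD').1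
        have h3 := congrArg (fun E => E.erase a) h
        simpa [Finset.erase_insert (fun h => has (hD1 h)),
          Finset.erase_insert (fun h => has (hD2 h))] using h3
      · rw [Finset.disjoint_left]
        intro D hD hD'
        rw [Finset.mem_image] at hD'
        obtain ⟨E, -, rfl⟩ := hD'
        exact has ((Finset.mem_powersetCard.1 hD).1 (Finset.mem_insert_self _ _))

end InsertionSum

section ParentFunctions

variable {V : Type*}

/-- `v` reaches a root (a point with parent `none`) by iterating the parent function `p`. As
accessibility, this gives induction from the parents to their children. -/
def ReachesRoot (p : V → Option V) (v : V) : Prop := Acc (fun u v => p v = some u) v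

theorem ReachesRoot.intro {p : V → Option V} {v : V} (h : ∀ u, p v = some u → ReachesRoot p u) :
    ReachesRoot p v := Acc.intro v h

theorem ReachesRoot.parent {p : V → Option V} {u v : V} (h : ReachesRoot p v) (huv : p v = some u) :
    ReachesRoot p u := h.inv huv

/-- `p` is the parent function of a forest. -/
def IsForest (p : V → Option V) : Prop := ∀ v, ReachesRoot p v

/-- The roots are smaller than their children. -/
def HasSmallRoots [LT V] (p : V → Option V) : Prop := ∀ u v, p v = some u → p u = none → u < v

/-- The set of roots. -/
def rootSet [Fintype V] [DecidableEq V] (p : V → Option V) : Finset V :=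
  Finset.univ.filter fun v => p v = none

theorem mem_rootSet [Fintype V] [DecidableEq V] {p : V → Option V} {v : V} :
    v ∈ rootSet p ↔ p v = none := by simp [rootSet]

variable [DecidableEq V]

/-- The parent function which is the endofunction `f` on `Z` and the parent function `q` off `Z`. -/
def glueParent (Z : Finset V) (f : {v // v ∈ Z} → {v // v ∈ Z})
    (q : {v // v ∉ Z} → Option {v // v ∉ Z}) (v : V) : Option V :=
  if h : v ∈ Z then some (f ⟨v, h⟩) else (q ⟨v, h⟩).map Subtype.val

section Glue

variable {Z : Finset V} {f : {v // v ∈ Z} → {v // v ∈ Z}}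
  {q : {v // v ∉ Z} → Option {v // v ∉ Z}}

theorem glueParent_of_mem {v : V} (h : v ∈ Z) : glueParent Z f q v = some (f ⟨v, h⟩ : V) := by
  simp [glueParent, h]

theorem glueParent_coe (v : {v // v ∉ Z}) : glueParent Z f q v = (q v).map Subtype.val := by
  simp [glueParent, v.2]

theorem glueParent_coe_eq_coe {v u : {v // v ∉ Z}} :
    glueParent Z f q v = some (u : V) ↔ q v = some u := by
  rw [glueParent_coe, Option.map_eq_some_iff]
  constructor
  · rintro ⟨w, hw, h⟩
    rw [hw, Subtype.ext h]
  · exact fun h => ⟨u, h, rfl⟩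

theorem glueParent_eq_some_of_notMem {v u : V} (hv : v ∉ Z) (h : glueParent Z f q v = some u) :
    ∃ hu : u ∉ Z, q ⟨v, hv⟩ = some ⟨u, hu⟩ := by
  have h1 := glueParent_coe (Z := Z) (f := f) (q := q) ⟨v, hv⟩
  rw [h, eq_comm, Option.map_eq_some_iff] at h1
  obtain ⟨w, hw, rfl⟩ := h1
  exact ⟨w.2, hw⟩

theorem glueParent_eq_none {v : V} :
    glueParent Z f q v = none ↔ ∃ hv : v ∉ Z, q ⟨v, hv⟩ = none := by
  by_cases h : v ∈ Z <;> simp [glueParent, h]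

theorem not_reachesRoot_glueParent {v : V} (hv : v ∈ Z) : ¬ReachesRoot (glueParent Z f q) v := by
  intro h
  induction h with
  | intro v _ ih => exact ih _ (glueParent_of_mem hv) (f ⟨v, hv⟩).2

theorem reachesRoot_glueParent (hq : IsForest q) (v : {v // v ∉ Z}) :
    ReachesRoot (glueParent Z f q) v := by
  have h := hq v
  induction h with
  | intro v _ ih =>
    refine ReachesRoot.intro fun u hu => ?_
    obtain ⟨hu', h⟩ := glueParent_eq_some_of_notMem v.2 hu
    exact ih ⟨u, hu'⟩ h

theorem reachesRoot_of_glueParent (v : {v // v ∉ Z}) (h : ReachesRoot (glueParent Z f q) v) :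
    ReachesRoot q v := by
  generalize hw : (v : V) = w at h
  induction h generalizing v with
  | intro w _ ih =>
    subst hw
    exact ReachesRoot.intro fun u hu => ih u (glueParent_coe_eq_coe.2 hu) u rfl

theorem hasSmallRoots_glueParent [LT V] :
    HasSmallRoots (glueParent Z f q) ↔ HasSmallRoots q := by
  constructor
  · intro h u v huv hu
    exact h u v (glueParent_coe_eq_coe.2 huv) (glueParent_eq_none.2 ⟨u.2, hu⟩)
  · intro h u v huv hu
    obtain ⟨hu', hu⟩ := glueParent_eq_none.1 hu
    have hv : v ∉ Z := by
      intro hv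
      rw [glueParent_of_mem hv, Option.some_inj] at huv
      exact hu' (huv ▸ (f ⟨v, hv⟩).2)
    obtain ⟨_, h1⟩ := glueParent_eq_some_of_notMem hv huv
    exact h _ _ h1 hu

theorem card_rootSet_glueParent [Fintype V] :
    (rootSet (glueParent Z f q)).card = (rootSet q).card := by
  rw [← Finset.card_map (Function.Embedding.subtype _)]
  congr 1
  ext v
  simp only [mem_rootSet, glueParent_eq_none, Finset.mem_map, Function.Embedding.coe_subtype,
    Subtype.exists, exists_and_right, exists_eq_right]

theorem glueParent_injective (Z : Finset V) :
    Function.Injective fun x : ({v // v ∈ Z} → {v // v ∈ Z}) ×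
      ({v // v ∉ Z} → Option {v // v ∉ Z}) => glueParent Z x.1 x.2 := by
  rintro ⟨f, q⟩ ⟨f', q'⟩ h
  have h' : ∀ v, glueParent Z f q v = glueParent Z f' q' v := congrFun h
  refine Prod.ext (funext fun v => Subtype.ext ?_) (funext fun v => ?_)
  · have := h' v
    rwa [glueParent_of_mem v.2, glueParent_of_mem v.2, Option.some_inj] at this
  · have := h' v
    rw [glueParent_coe, glueParent_coe] at this
    exact Option.map_injective Subtype.val_injective this

end Glue

theorem exists_glueParent_eq (p : V → Option V) (Z : Finset V)
    (hZ : ∀ v, v ∈ Z ↔ ¬ReachesRoot p v) : ∃ f q, glueParent Z f q = p ∧ IsForest q := by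
  have h1 : ∀ v : {v // v ∈ Z}, ∃ u : {v // v ∈ Z}, p v = some (u : V) := by
    intro v
    by_contra hcon
    refine (hZ v).1 v.2 (ReachesRoot.intro fun u hu => ?_)
    by_contra hu'
    exact hcon ⟨⟨u, (hZ u).2 hu'⟩, hu⟩
  choose f hf using h1
  have h2 : ∀ v : {v // v ∉ Z}, ∃ o : Option {v // v ∉ Z}, p v = o.map Subtype.val := by
    intro v
    cases hv : p v with
    | none => exact ⟨none, rfl⟩
    | some u =>
      have : ReachesRoot p v := not_not.1 fun h => v.2 ((hZ v).2 h)
      exact ⟨some ⟨u, fun hu => (hZ u).1 hu (this.parent hv)⟩, rfl⟩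
  choose q hq using h2
  have hglue : glueParent Z f q = p := by
    funext v
    by_cases hv : v ∈ Z
    · rw [glueParent_of_mem hv, ← hf]
    · exact (glueParent_coe (⟨v, hv⟩ : {v // v ∉ Z})).trans (hq ⟨v, hv⟩).symm
  refine ⟨f, q, hglue, fun v => ?_⟩
  apply reachesRoot_of_glueParent (f := f)
  rw [hglue]
  exact not_not.1 fun h => v.2 ((hZ v).2 h)

end ParentFunctions

section Counting

open Classical in
/-- The forests on `V` with `K` roots, each of which is smaller than its children, as parent
functions. -/
noncomputable def smallRootForests (V : Type*) [Fintype V] [LinearOrder V] (K : ℕ) :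
    Finset (V → Option V) :=
  Finset.univ.filter fun p => HasSmallRoots p ∧ (rootSet p).card = K ∧ IsForest p

variable {V : Type*} [Fintype V] [LinearOrder V]

open Classical in
theorem card_filter_not_reachesRoot_eq (Z : Finset V) (K : ℕ) :
    (Finset.univ.filter fun p : V → Option V => (HasSmallRoots p ∧ (rootSet p).card = K) ∧
      Finset.univ.filter (fun v => ¬ReachesRoot p v) = Z).card =
      Z.card ^ Z.card * (smallRootForests {v // v ∉ Z} K).card := by
  have h1 : Z.card ^ Z.card * (smallRootForests {v // v ∉ Z} K).card =
      ((Finset.univ : Finset ({v // v ∈ Z} → {v // v ∈ Z})) ×ˢ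
        smallRootForests {v // v ∉ Z} K).card := by
    rw [Finset.card_product, Finset.card_univ, Fintype.card_fun, Fintype.card_coe]
  rw [h1, eq_comm]
  refine Finset.card_bij (fun x _ => glueParent Z x.1 x.2) ?_ ?_ ?_
  · rintro ⟨f, q⟩ hx
    simp only [smallRootForests, Finset.mem_product, Finset.mem_univ, Finset.mem_filter,
      true_and] at hx ⊢
    refine ⟨⟨hasSmallRoots_glueParent.2 hx.1, card_rootSet_glueParent.trans hx.2.1⟩, ?_⟩
    ext v
    simp only [Finset.mem_filter, Finset.mem_univ, true_and]
    constructor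
    · exact fun h => by_contra fun hv => h (reachesRoot_glueParent hx.2.2 ⟨v, hv⟩)
    · exact not_reachesRoot_glueParent
  · exact fun x _ y _ h => glueParent_injective Z h
  · intro p hp
    simp only [Finset.mem_filter, Finset.mem_univ, true_and] at hp
    obtain ⟨f, q, rfl, hq⟩ := exists_glueParent_eq p Z (by simp [← hp.2])
    refine ⟨(f, q), ?_, rfl⟩
    simp only [smallRootForests, Finset.mem_product, Finset.mem_univ, Finset.mem_filter, true_and]
    exact ⟨hasSmallRoots_glueParent.1 hp.1.1, card_rootSet_glueParent.symm.trans hp.1.2, hq⟩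

open Classical in
/-- A parent function, not necessarily of a forest, splits into an endofunction of the set `Z` of the
points which do not reach a root, and a forest off `Z`. -/
theorem card_hasSmallRoots_eq_sum (V : Type*) [Fintype V] [LinearOrder V] (K : ℕ) :
    (Finset.univ.filter fun p : V → Option V => HasSmallRoots p ∧ (rootSet p).card = K).card =
      (smallRootForests V K).card + ∑ Z ∈ (Finset.univ : Finset V).powerset.erase ∅,
        Z.card ^ Z.card * (smallRootForests {v // v ∉ Z} K).card := by
  rw [Finset.card_eq_sum_card_fiberwise (t := (Finset.univ : Finset V).powerset)
    (f := fun p : V → Option V => Finset.univ.filter fun v => ¬ReachesRoot p v)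
    (fun p _ => by simp),
    ← Finset.add_sum_erase _ _ (Finset.empty_mem_powerset _)]
  congr 1
  · rw [Finset.filter_filter]
    refine congrArg Finset.card (Finset.filter_congr fun p _ => ?_)
    rw [and_assoc, Finset.filter_eq_empty_iff]
    simp [IsForest]
  · refine Finset.sum_congr rfl fun Z _ => ?_
    rw [Finset.filter_filter, ← card_filter_not_reachesRoot_eq]

open Classical in
/-- For a given set `D` of roots, the parent of any other point `v` can be a point off `D` or an element
of `D` smaller than `v`. -/
theorem card_hasSmallRoots_eq_sum_powersetCard (V : Type*) [Fintype V] [LinearOrder V] (K : ℕ) :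
    (Finset.univ.filter fun p : V → Option V => HasSmallRoots p ∧ (rootSet p).card = K).card =
      ∑ D ∈ (Finset.univ : Finset V).powersetCard K, ∏ v ∈ Finset.univ \ D,
        ((Fintype.card V - K) + (D.filter (· < v)).card) := by
  rw [Finset.card_eq_sum_card_fiberwise (t := (Finset.univ : Finset V).powersetCard K)
    (f := rootSet) (fun p hp => by simpa using (Finset.mem_filter.1 hp).2.2)]
  refine Finset.sum_congr rfl fun D hD => ?_
  rw [Finset.mem_powersetCard] at hD
  have h1 : ((Finset.univ.filter fun p : V → Option V =>
      HasSmallRoots p ∧ (rootSet p).card = K).filter fun p => rootSet p = D) =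
      Fintype.piFinset fun v => if v ∈ D then {none} else
        (Dᶜ ∪ D.filter (· < v)).map Function.Embedding.some := by
    ext p
    simp only [Finset.mem_filter, Finset.mem_univ, true_and, Fintype.mem_piFinset]
    constructor
    · rintro ⟨⟨h, -⟩, rfl⟩ v
      split_ifs with hv
      · rw [mem_rootSet] at hv
        simp [hv]
      · rw [mem_rootSet] at hv
        obtain ⟨u, hu⟩ := Option.ne_none_iff_exists'.1 hv
        have := h u v hu
        by_cases hu' : p u = none <;> simp_all [mem_rootSet]
    · intro h
      have hr : rootSet p = D := by
        ext v
        rw [mem_rootSet]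
        have := h v
        split_ifs at this with hv
        · simpa [hv] using this
        · rw [Finset.mem_map] at this
          obtain ⟨u, -, hu⟩ := this
          simp [hv, ← hu]
      refine ⟨⟨fun u v huv hu => ?_, by rw [hr, hD.2]⟩, hr⟩
      have h2 := h v
      have huD : u ∈ D := by rw [← hr, mem_rootSet, hu]
      split_ifs at h2 with hv
      · simp [huv] at h2
      · rw [huv, Finset.mem_map] at h2
        obtain ⟨w, hw, hwu⟩ := h2
        obtain rfl : w = u := Option.some_injective _ hwu
        simpa [huD] using hw
  rw [h1, Fintype.card_piFinset, ← Finset.prod_sdiff (Finset.subset_univ D)]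
  rw [Finset.prod_eq_one (s := D) (fun v hv => by simp [hv]), mul_one]
  refine Finset.prod_congr rfl fun v hv => ?_
  rw [Finset.mem_sdiff] at hv
  rw [if_neg hv.2, Finset.card_map, Finset.card_union_of_disjoint, Finset.card_compl, hD.2]
  exact Finset.disjoint_left.2 fun x hx hx' => Finset.mem_compl.1 hx (Finset.mem_filter.1 hx').1

open Classical in
theorem card_hasSmallRoots {A : ℕ → ℕ → ℕ} (hA : SatisfiesBlockRecursion A)
    (V : Type*) [Fintype V] [LinearOrder V] (K : ℕ) :
    (Finset.univ.filter fun p : V → Option V => HasSmallRoots p ∧ (rootSet p).card = K).card =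
      A (Fintype.card V + 1) (K + 1) := by
  rw [card_hasSmallRoots_eq_sum_powersetCard]
  have h0 : (K ! : ℚ) ≠ 0 := by exact_mod_cast Nat.factorial_ne_zero K
  rcases le_or_gt K (Fintype.card V) with hK | hK
  · have h1 := factorial_mul_sum_powersetCard_prod (Finset.univ : Finset V) K (Fintype.card V - K)
    rw [Finset.card_univ, Nat.cast_sub hK, sub_add_cancel, ← hA.factorial_mul_succ_succ] at h1
    exact_mod_cast mul_left_cancel₀ h0 h1
  · rw [Finset.powersetCard_eq_empty.2 (by rwa [Finset.card_univ]), Finset.sum_empty,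
      hA.eq_zero_of_lt (by omega)]

/-- The forests on `N` points with `K` roots smaller than their children are as many as the
partitions of `N` points into `K` blocks with an endofunction of each block without its smallest
element. -/
theorem card_smallRootForests {A : ℕ → ℕ → ℕ} (hA : SatisfiesBlockRecursion A)
    (V : Type*) [Fintype V] [LinearOrder V] (K : ℕ) :
    (smallRootForests V K).card = A (Fintype.card V) K := by
  induction hn : Fintype.card V using Nat.strong_induction_on generalizing V with
  | _ n ih =>
    have h1 := card_hasSmallRoots_eq_sum V K
    have h2 := Finset.sum_powerset_apply_card (x := (Finset.univ : Finset V))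
      (fun z => z ^ z * A (n - z) K)
    rw [card_hasSmallRoots hA, hn, hA.succ_succ] at h1
    rw [Finset.card_univ, hn, ← Finset.add_sum_erase _ _ (Finset.empty_mem_powerset _)] at h2
    simp only [smul_eq_mul, ← mul_assoc] at h2
    rw [← h2] at h1
    have h3 : ∑ Z ∈ (Finset.univ : Finset V).powerset.erase ∅,
        Z.card ^ Z.card * (smallRootForests {v // v ∉ Z} K).card =
        ∑ Z ∈ (Finset.univ : Finset V).powerset.erase ∅, Z.card ^ Z.card * A (n - Z.card) K := by
      refine Finset.sum_congr rfl fun Z hZ => ?_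
      have hZ0 : 0 < Z.card := Finset.card_pos.2
        (Finset.nonempty_iff_ne_empty.2 (Finset.ne_of_mem_erase hZ))
      have hle : Z.card ≤ n := hn ▸ Finset.card_le_univ Z
      have hc : Fintype.card {v // v ∉ Z} = n - Z.card := by
        rw [Fintype.card_subtype_compl, Fintype.card_coe, hn]
      rw [ih (n - Z.card) (by omega) _ hc]
    rw [h3] at h1
    simp only [Finset.card_empty, pow_zero, one_mul, Nat.sub_zero] at h1
    exact (Nat.add_right_cancel h1).symm

end Counting

/-! ### Rooted trees and their parent functions -/

namespace LabeledRootedTree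

variable {V : Type*}

theorem ext' {T T' : LabeledRootedTree V} (hg : T.graph = T'.graph) (hr : T.root = T'.root) :
    T = T' := by
  cases T
  cases T'
  simp_all

variable (T : LabeledRootedTree V)

theorem length_eq_dist {v : V} {P : T.graph.Walk T.root v} (hP : P.IsPath) :
    P.length = T.graph.dist T.root v := by
  obtain ⟨Q, hQ, h⟩ := T.isTree.connected.exists_path_of_dist T.root v
  rw [← h, show P = Q from congrArg Subtype.val
    ((T.isTree.isAcyclic.subsingleton_path _ _).elim ⟨P, hP⟩ ⟨Q, hQ⟩)]

variable {T}

theorem IsChild.isPath_concat {u v : V} (h : T.IsChild u v) {Q : T.graph.Walk T.root u}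
    (hQ : Q.IsPath) : (Q.concat h.1).IsPath := by
  apply SimpleGraph.Walk.isPath_of_length_eq_dist
  rw [SimpleGraph.Walk.length_concat, T.length_eq_dist hQ, h.2]

theorem IsChild.eq_concat {u v : V} (h : T.IsChild u v) {Q : T.graph.Walk T.root u}
    (hQ : Q.IsPath) {P : T.graph.Walk T.root v} (hP : P.IsPath) : P = Q.concat h.1 :=
  congrArg Subtype.val ((T.isTree.isAcyclic.subsingleton_path _ _).elim ⟨P, hP⟩ ⟨_, h.isPath_concat hQ⟩)

theorem IsChild.parent_unique {u u' v : V} (h : T.IsChild u v) (h' : T.IsChild u' v) : u = u' := by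
  obtain ⟨Q, hQ, -⟩ := T.isTree.connected.exists_path_of_dist T.root u
  obtain ⟨Q', hQ', -⟩ := T.isTree.connected.exists_path_of_dist T.root u'
  have h1 := h.eq_concat hQ (h'.isPath_concat hQ')
  have h2 := congrArg SimpleGraph.Walk.penultimate h1
  simpa using h2.symm

theorem not_isChild_root (u : V) : ¬T.IsChild u T.root := by
  rintro ⟨-, h⟩
  rw [SimpleGraph.dist_self] at h
  omega

variable (T) in
theorem exists_isChild {v : V} (hv : v ≠ T.root) : ∃ u, T.IsChild u v := by
  obtain ⟨P, hP, -⟩ := T.isTree.connected.exists_path_of_dist T.root v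
  have hnil : ¬P.Nil := fun h => hv h.eq.symm
  have hadj := P.adj_penultimate hnil
  refine ⟨P.penultimate, hadj, ?_⟩
  have h1 := P.concat_dropLast hadj
  have h2 : P.dropLast.IsPath := by
    have := h1 ▸ hP
    rw [SimpleGraph.Walk.concat_eq_append] at this
    exact this.of_append_left
  rw [← T.length_eq_dist hP, ← T.length_eq_dist h2]
  conv_lhs => rw [← h1]
  rw [SimpleGraph.Walk.length_concat]

theorem isChild_or_isChild {u v : V} (h : T.graph.Adj u v) : T.IsChild u v ∨ T.IsChild v u := by
  rcases T.isTree.dist_eq_dist_add_one_of_adj T.root h with h1 | h1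
  · exact Or.inr ⟨h.symm, h1⟩
  · exact Or.inl ⟨h, h1⟩

theorem mem_mdVerts_iff [LinearOrder V] {v : V} :
    v ∈ T.mdVerts ↔ v = T.root ∨ ∃ u, T.IsChild u v ∧ u ∈ T.mdVerts ∧ v < u := by
  constructor
  · rintro ⟨P, hP⟩
    by_cases hv : v = T.root
    · exact Or.inl hv
    · obtain ⟨u, hu⟩ := T.exists_isChild hv
      obtain ⟨Q, hQ, -⟩ := T.isTree.connected.exists_path_of_dist T.root u
      rw [hu.eq_concat hQ P.2, SimpleGraph.Walk.support_concat,
        List.pairwise_append] at hP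
      exact Or.inr ⟨u, hu, ⟨⟨Q, hQ⟩, hP.1⟩, hP.2.2 u Q.end_mem_support v (by simp)⟩
  · rintro (rfl | ⟨u, hu, ⟨Q, hQ⟩, hvu⟩)
    · exact ⟨SimpleGraph.Path.nil, by simp⟩
    · refine ⟨⟨_, hu.isPath_concat Q.2⟩, ?_⟩
      rw [SimpleGraph.Walk.support_concat, List.pairwise_append]
      refine ⟨hQ, by simp, fun x hx y hy => ?_⟩
      obtain rfl : y = v := by simpa using hy
      -- the end `u` of a decreasing path is its smallest vertex
      have hux : u ≤ x := by
        have hQ' := List.dropLast_append_getLast (Q : T.graph.Walk T.root u).support_ne_nil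
        rw [SimpleGraph.Walk.getLast_support] at hQ'
        rw [← hQ', List.pairwise_append] at hQ
        rw [← hQ', List.mem_append, List.mem_singleton] at hx
        rcases hx with hx | rfl
        · exact (hQ.2.2 x hx u (by simp)).le
        · exact le_rfl
      exact hvu.trans_le hux

open Classical in
variable (T) in
/-- The function mapping each vertex to its parent, and the root to `none`. -/
noncomputable def parent (v : V) : Option V :=
  if h : ∃ u, T.IsChild u v then some h.choose else none

theorem parent_eq_some {u v : V} : T.parent v = some u ↔ T.IsChild u v := by
  unfold parent
  constructor
  · intro h
    split_ifs at h with hc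
    exact Option.some_inj.1 h ▸ hc.choose_spec
  · intro h
    have hc : ∃ u, T.IsChild u v := ⟨u, h⟩
    rw [dif_pos hc, hc.choose_spec.parent_unique h]

theorem parent_eq_none {v : V} : T.parent v = none ↔ v = T.root := by
  constructor
  · intro h
    by_contra hv
    obtain ⟨u, hu⟩ := T.exists_isChild hv
    rw [parent_eq_some.2 hu] at h
    exact Option.some_ne_none _ h
  · rintro rfl
    exact Option.eq_none_iff_forall_ne_some.2 fun u hu => not_isChild_root u (parent_eq_some.1 hu)

theorem isForest_parent : IsForest T.parent := by
  intro v
  induction hd : T.graph.dist T.root v using Nat.strong_induction_on generalizing v with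
  | _ d ih =>
    refine ReachesRoot.intro fun u hu => ?_
    have := (parent_eq_some.1 hu).2
    exact ih _ (by omega) u rfl

theorem adj_iff_parent {u v : V} :
    T.graph.Adj u v ↔ T.parent v = some u ∨ T.parent u = some v := by
  rw [parent_eq_some, parent_eq_some]
  exact ⟨isChild_or_isChild, fun h => h.elim (fun h => h.1) fun h => h.1.symm⟩

theorem parent_injective : Function.Injective (parent : LabeledRootedTree V → V → Option V) := by
  intro T T' h
  refine ext' ?_ ?_
  · ext u v
    rw [adj_iff_parent, adj_iff_parent, h]
  · rw [← parent_eq_none (T := T'), ← h, parent_eq_none]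

theorem rootSet_parent [Fintype V] [DecidableEq V] : rootSet T.parent = {T.root} := by
  ext v
  rw [mem_rootSet, parent_eq_none, Finset.mem_singleton]

end LabeledRootedTree

section TreeOfParent

variable {V : Type*}

/-- The graph with the edges joining the points to their parents. -/
def parentGraph (p : V → Option V) : SimpleGraph V :=
  SimpleGraph.fromRel fun u v => p u = some v

theorem IsForest.ne {p : V → Option V} (hp : IsForest p) {u v : V} (h : p v = some u) : v ≠ u := by
  rintro rfl
  have : ∀ w, ReachesRoot p w → p w ≠ some w := by
    intro w hw
    induction hw with
    | intro w _ ih => exact fun hw => ih w hw hw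
  exact this v (hp v) h

theorem IsForest.asymm {p : V → Option V} (hp : IsForest p) {u v : V} (h : p v = some u)
    (h' : p u = some v) : False := by
  have : ∀ w, ReachesRoot p w → ∀ x, p w = some x → p x ≠ some w := by
    intro w hw
    induction hw with
    | intro w _ ih => exact fun x hwx hxw => ih x hwx w hxw hwx
  exact this v (hp v) u h h'

theorem IsForest.adj_parentGraph {p : V → Option V} (hp : IsForest p) {u v : V} :
    (parentGraph p).Adj u v ↔ p v = some u ∨ p u = some v := by
  rw [parentGraph, SimpleGraph.fromRel_adj]
  constructor
  · exact fun h => h.2.symm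
  · rintro (h | h)
    · exact ⟨(hp.ne h).symm, Or.inr h⟩
    · exact ⟨hp.ne h, Or.inl h⟩

variable [Fintype V] [DecidableEq V]

theorem IsForest.isTree_parentGraph {p : V → Option V} (hp : IsForest p) {r : V}
    (hr : rootSet p = {r}) : (parentGraph p).IsTree := by
  have hreach : ∀ v, (parentGraph p).Reachable v r := by
    intro v
    have h := hp v
    induction h with
    | intro v _ ih =>
      cases hv : p v with
      | none =>
        rw [← mem_rootSet, hr, Finset.mem_singleton] at hv
        rw [hv]
      | some u =>
        have h1 : (parentGraph p).Adj v u := hp.adj_parentGraph.2 (Or.inr hv)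
        exact h1.reachable.trans (ih u hv)
  have hconn : (parentGraph p).Connected :=
    { preconnected := fun u v => (hreach u).trans (hreach v).symm
      nonempty := ⟨r⟩ }
  refine SimpleGraph.isTree_iff_connected_and_card.2 ⟨hconn, le_antisymm ?_
    hconn.card_vert_le_card_edgeSet_add_one⟩
  -- every edge joins a point other than the root to its parent
  have hsub : (parentGraph p).edgeSet ⊆
      (fun v => s(v, (p v).getD v)) '' (({r} : Finset V)ᶜ : Finset V) := by
    intro e he
    induction e with
    | _ u v =>
      rw [SimpleGraph.mem_edgeSet, hp.adj_parentGraph] at he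
      have key : ∀ a b, p a = some b → s(a, b) ∈
          (fun v => s(v, (p v).getD v)) '' (({r} : Finset V)ᶜ : Finset V) := by
        intro a b hab
        refine ⟨a, ?_, by simp [hab]⟩
        rw [← hr, Finset.mem_coe, Finset.mem_compl, mem_rootSet, hab]
        exact Option.some_ne_none _
      rcases he with h | h
      · rw [Sym2.eq_swap]
        exact key _ _ h
      · exact key _ _ h
  have h1 := (Set.ncard_le_ncard hsub (Set.toFinite _)).trans (Set.ncard_image_le (Set.toFinite _))
  rw [Set.ncard_coe_finset, Finset.card_compl, Finset.card_singleton] at h1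
  rw [Nat.card_coe_set_eq, Nat.card_eq_fintype_card]
  have : 0 < Fintype.card V := Fintype.card_pos_iff.2 ⟨r⟩
  omega

theorem exists_tree_parent_eq {p : V → Option V}
    (hp : IsForest p) {r : V} (hr : rootSet p = {r}) :
    ∃ T : LabeledRootedTree V, T.parent = p := by
  let T : LabeledRootedTree V := ⟨parentGraph p, hp.isTree_parentGraph hr, r⟩
  have hroot : ∀ v, p v = none ↔ v = r := fun v => by
    rw [← mem_rootSet, hr, Finset.mem_singleton]
  have key : ∀ v, ∀ u, p v = some u → T.IsChild u v := by
    intro v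
    have h := hp v
    induction h with
    | intro v _ ih =>
      intro u hu
      have hadj : T.graph.Adj u v := hp.adj_parentGraph.2 (Or.inl hu)
      rcases LabeledRootedTree.isChild_or_isChild hadj with h | h
      · exact h
      · exfalso
        cases hpu : p u with
        | none =>
          obtain rfl := (hroot u).1 hpu
          exact LabeledRootedTree.not_isChild_root v h
        | some w =>
          have hw := ih u hu w hpu
          obtain rfl := hw.parent_unique h
          exact hp.asymm hu hpu
  refine ⟨T, funext fun v => ?_⟩
  cases hv : p v with
  | none => exact LabeledRootedTree.parent_eq_none.2 ((hroot v).1 hv)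
  | some u => exact LabeledRootedTree.parent_eq_some.2 (key v u hv)

end TreeOfParent

/-! ### The maximal decreasing subtree -/

section Decreasing

variable {V : Type*}

/-- The points from which iterating the parent function increases up to a root: the points of the
maximal decreasing subtree. -/
inductive InDecreasing [LT V] (p : V → Option V) : V → Prop
  | root {v : V} (h : p v = none) : InDecreasing p v
  | step {u v : V} (h : p v = some u) (hu : InDecreasing p u) (hvu : v < u) : InDecreasing p v

theorem inDecreasing_iff_of_eq_some [LT V] {p : V → Option V} {u v : V} (h : p v = some u) :
    InDecreasing p v ↔ InDecreasing p u ∧ v < u := by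
  constructor
  · rintro (h' | ⟨h', hu, hvu⟩)
    · simp [h] at h'
    · obtain rfl := Option.some_inj.1 (h'.symm.trans h)
      exact ⟨hu, hvu⟩
  · exact fun h' => .step h h'.1 h'.2

variable [LinearOrder V]

theorem LabeledRootedTree.mem_mdVerts_iff_inDecreasing (T : LabeledRootedTree V) (v : V) :
    v ∈ T.mdVerts ↔ InDecreasing T.parent v := by
  have h := LabeledRootedTree.isForest_parent (T := T) v
  induction h with
  | intro v _ ih =>
    cases hv : T.parent v with
    | none =>
      exact iff_of_true (LabeledRootedTree.mem_mdVerts_iff.2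
        (Or.inl (LabeledRootedTree.parent_eq_none.1 hv))) (.root hv)
    | some u =>
      have hc := LabeledRootedTree.parent_eq_some.1 hv
      have ih' : u ∈ T.mdVerts ↔ InDecreasing T.parent u := ih u hv
      rw [inDecreasing_iff_of_eq_some hv, ← ih', LabeledRootedTree.mem_mdVerts_iff]
      constructor
      · rintro (rfl | ⟨w, hw, h1, h2⟩)
        · exact absurd hc (LabeledRootedTree.not_isChild_root u)
        · obtain rfl := hw.parent_unique hc
          exact ⟨h1, h2⟩
      · exact fun h => Or.inr ⟨u, hc, h⟩

variable [Fintype V]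

open Classical in
/-- The parent functions of the decreasing trees on `D`, extended by `none` outside `D`. -/
noncomputable def decreasingTrees (D : Finset V) : Finset (V → Option V) :=
  Finset.univ.filter fun d => (∀ u v, d v = some u → v ∈ D ∧ u ∈ D ∧ v < u) ∧
    ∀ v ∈ D, ∀ w ∈ D, v < w → d v ≠ none

theorem mem_decreasingTrees {D : Finset V} {d : V → Option V} :
    d ∈ decreasingTrees D ↔ (∀ u v, d v = some u → v ∈ D ∧ u ∈ D ∧ v < u) ∧
      ∀ v ∈ D, ∀ w ∈ D, v < w → d v ≠ none := by simp [decreasingTrees]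

/-- The parent function in which the roots of the forest `q` get the parents given by `d`. -/
def graft (q d : V → Option V) (v : V) : Option V := (q v).or (d v)

theorem graft_of_mem {q d : V → Option V} {v : V} (h : v ∈ rootSet q) : graft q d v = d v := by
  rw [mem_rootSet] at h
  simp [graft, h]

theorem graft_of_notMem {q d : V → Option V} {v : V} (h : v ∉ rootSet q) : graft q d v = q v := by
  rw [mem_rootSet] at h
  obtain ⟨u, hu⟩ := Option.ne_none_iff_exists'.1 h
  simp [graft, hu]

section Graft

variable {q d : V → Option V}

theorem isForest_graft (hq : IsForest q) (hd : d ∈ decreasingTrees (rootSet q)) :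
    IsForest (graft q d) := by
  rw [mem_decreasingTrees] at hd
  have h1 : ∀ v, v ∈ rootSet q → ReachesRoot (graft q d) v := by
    intro v
    induction v using WellFoundedGT.induction with
    | ind v ih =>
      intro hv
      refine ReachesRoot.intro fun u hu => ?_
      rw [graft_of_mem hv] at hu
      have := hd.1 u v hu
      exact ih u this.2.2 this.2.1
  intro v
  have h := hq v
  induction h with
  | intro v _ ih =>
    by_cases hv : v ∈ rootSet q
    · exact h1 v hv
    · refine ReachesRoot.intro fun u hu => ?_
      rw [graft_of_notMem hv] at hu
      exact ih u hu

theorem rootSet_graft (hd : d ∈ decreasingTrees (rootSet q)) (hne : (rootSet q).Nonempty) :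
    rootSet (graft q d) = {(rootSet q).max' hne} := by
  rw [mem_decreasingTrees] at hd
  ext v
  rw [mem_rootSet, Finset.mem_singleton]
  have hmax := (rootSet q).max'_mem hne
  constructor
  · intro h
    have hv : v ∈ rootSet q := by
      by_contra hv
      rw [graft_of_notMem hv, ← mem_rootSet] at h
      exact hv h
    rw [graft_of_mem hv] at h
    by_contra hne'
    exact hd.2 v hv _ hmax (lt_of_le_of_ne (Finset.le_max' _ v hv) hne') h
  · rintro rfl
    rw [graft_of_mem hmax]
    refine Option.eq_none_iff_forall_ne_some.2 fun u hu => ?_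
    have := hd.1 _ _ hu
    exact this.2.2.not_ge (Finset.le_max' _ u this.2.1)

theorem inDecreasing_graft_iff (hs : HasSmallRoots q) (hd : d ∈ decreasingTrees (rootSet q))
    (v : V) : InDecreasing (graft q d) v ↔ v ∈ rootSet q := by
  rw [mem_decreasingTrees] at hd
  constructor
  · intro h
    by_contra hv
    induction h with
    | root h =>
      rw [graft_of_notMem hv, ← mem_rootSet] at h
      exact hv h
    | @step u v h hu hvu ih =>
      rw [graft_of_notMem hv] at h
      have hu' : u ∈ rootSet q := not_not.1 ih
      exact (hs u v h (mem_rootSet.1 hu')).not_gt hvu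
  · induction v using WellFoundedGT.induction with
    | ind v ih =>
      intro hv
      cases hdv : d v with
      | none => exact .root (by rw [graft_of_mem hv, hdv])
      | some u =>
        have := hd.1 u v hdv
        exact .step (by rw [graft_of_mem hv, hdv]) (ih u this.2.2 this.2.1) this.2.2

theorem graft_injective {q' d' : V → Option V} (hs : HasSmallRoots q)
    (hd : d ∈ decreasingTrees (rootSet q)) (hs' : HasSmallRoots q')
    (hd' : d' ∈ decreasingTrees (rootSet q')) (h : graft q d = graft q' d') :
    q = q' ∧ d = d' := by
  have hr : rootSet q = rootSet q' := by
    ext v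
    rw [← inDecreasing_graft_iff hs hd, h, inDecreasing_graft_iff hs' hd']
  have hout : ∀ (D : Finset V) (e : V → Option V), e ∈ decreasingTrees D → ∀ v ∉ D, e v = none := by
    intro D e he v hv
    rw [mem_decreasingTrees] at he
    exact Option.eq_none_iff_forall_ne_some.2 fun u hu => hv (he.1 u v hu).1
  constructor
  · funext v
    by_cases hv : v ∈ rootSet q
    · have hv' : v ∈ rootSet q' := hr ▸ hv
      rw [mem_rootSet.1 hv, mem_rootSet.1 hv']
    · rw [← graft_of_notMem (d := d) hv, h, graft_of_notMem (hr ▸ hv)]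
  · funext v
    by_cases hv : v ∈ rootSet q
    · rw [← graft_of_mem (d := d) hv, h, graft_of_mem (hr ▸ hv)]
    · rw [hout _ _ hd v hv, hout _ _ hd' v (hr ▸ hv)]

open Classical in
/-- Cutting off the maximal decreasing subtree of a tree leaves a forest whose roots are smaller than
their children. -/
theorem exists_graft_eq {p : V → Option V} (hp : IsForest p) {r : V} (hr : rootSet p = {r}) :
    ∃ q d, HasSmallRoots q ∧ IsForest q ∧
      rootSet q = Finset.univ.filter (InDecreasing p) ∧ d ∈ decreasingTrees (rootSet q) ∧
      graft q d = p := by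
  have hroot : ∀ {v}, p v = none ↔ v = r := fun {v} => by
    rw [← mem_rootSet, hr, Finset.mem_singleton]
  let q : V → Option V := fun v => if InDecreasing p v then none else p v
  let d : V → Option V := fun v => if InDecreasing p v then p v else none
  have hqr : rootSet q = Finset.univ.filter (InDecreasing p) := by
    ext v
    simp only [mem_rootSet, Finset.mem_filter, Finset.mem_univ, true_and, q]
    constructor
    · intro h
      by_contra hv
      rw [if_neg hv] at h
      exact hv (.root h)
    · exact fun h => if_pos h
  have hqs : ∀ {u v}, q v = some u → ¬InDecreasing p v ∧ p v = some u := by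
    intro u v h
    simp only [q] at h
    split_ifs at h with hv
    exact ⟨hv, h⟩
  have hds : ∀ {u v}, d v = some u → InDecreasing p v ∧ p v = some u := by
    intro u v h
    simp only [d] at h
    split_ifs at h with hv
    exact ⟨hv, h⟩
  refine ⟨q, d, ?_, ?_, hqr, ?_, ?_⟩
  · intro u v h hu
    obtain ⟨hv, hvu⟩ := hqs h
    rw [← mem_rootSet, hqr, Finset.mem_filter] at hu
    rcases lt_trichotomy u v with h1 | rfl | h1
    · exact h1
    · exact absurd hu.2 hv
    · exact absurd (.step hvu hu.2 h1) hv
  · intro v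
    have h := hp v
    induction h with
    | intro v _ ih => exact ReachesRoot.intro fun u hu => ih u (hqs hu).2
  · rw [mem_decreasingTrees, hqr]
    simp only [Finset.mem_filter, Finset.mem_univ, true_and]
    constructor
    · intro u v h
      obtain ⟨hv, hvu⟩ := hds h
      exact ⟨hv, (inDecreasing_iff_of_eq_some hvu).1 hv⟩
    · intro v hv w hw hvw h
      simp only [d, if_pos hv] at h
      have hle : ∀ x, InDecreasing p x → x ≤ r := by
        intro x hx
        induction hx with
        | root h => exact (hroot.1 h).le
        | step _ _ h ih => exact h.le.trans ih
      rw [hroot.1 h] at hvw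
      exact hvw.not_ge (hle w hw)
  · funext v
    by_cases hv : InDecreasing p v
    · simp [graft, q, d, hv]
    · simp [graft, q, d, hv]

end Graft

/-- Counting a class of trees determined by the shape of the maximal decreasing subtree. -/
theorem ncard_eq_of_forall_mem_iff {k c : ℕ} (hk : 1 ≤ k)
    (F : Finset V → Finset (V → Option V)) (hF : ∀ D, F D ⊆ decreasingTrees D)
    (hc : ∀ D : Finset V, D.card = k → (F D).card = c) (S : Set (LabeledRootedTree V))
    (hSk : ∀ T ∈ S, T.mdVerts.ncard = k)
    (hS : ∀ (T : LabeledRootedTree V) (q d : V → Option V), T.parent = graft q d →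
      T.mdVerts = rootSet q → (rootSet q).card = k → d ∈ decreasingTrees (rootSet q) →
      (T ∈ S ↔ d ∈ F (rootSet q))) :
    S.ncard = (smallRootForests V k).card * c := by
  classical
  have h1 : ((smallRootForests V k).sigma fun q => F (rootSet q)).card =
      (smallRootForests V k).card * c := by
    rw [Finset.card_sigma, Finset.sum_const_nat]
    intro q hq
    exact hc _ (Finset.mem_filter.1 hq).2.2.1
  rw [← h1, ← Set.ncard_image_of_injective S LabeledRootedTree.parent_injective,
    ← Finset.card_image_of_injOn (f := fun x : (Σ _ : V → Option V, V → Option V) => graft x.1 x.2),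
    ← Set.ncard_coe_finset]
  · congr 1
    ext p
    simp only [Set.mem_image, Finset.coe_image, Finset.mem_coe, Finset.mem_sigma, Sigma.exists]
    constructor
    · rintro ⟨T, hT, rfl⟩
      obtain ⟨q, d, hs, hq, hr, hd, hg⟩ := exists_graft_eq
        (LabeledRootedTree.isForest_parent (T := T)) LabeledRootedTree.rootSet_parent
      have hmd : T.mdVerts = rootSet q := by
        ext v
        simp [hr, T.mem_mdVerts_iff_inDecreasing]
      have hcard : (rootSet q).card = k := by
        rw [← hSk T hT, hmd, Set.ncard_coe_finset]
      refine ⟨q, d, ⟨?_, (hS T q d hg.symm hmd hcard hd).1 hT⟩, hg⟩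
      simp [smallRootForests, hs, hcard, hq]
    · rintro ⟨q, d, ⟨hq, hd⟩, rfl⟩
      simp only [smallRootForests, Finset.mem_filter, Finset.mem_univ, true_and] at hq
      have hne : (rootSet q).Nonempty := Finset.card_pos.1 (by omega)
      obtain ⟨T, hT⟩ := exists_tree_parent_eq (isForest_graft hq.2.2 (hF _ hd))
        (rootSet_graft (hF _ hd) hne)
      refine ⟨T, (hS T q d hT ?_ hq.2.1 (hF _ hd)).2 hd, hT⟩
      ext v
      rw [T.mem_mdVerts_iff_inDecreasing, hT, inDecreasing_graft_iff hq.1 (hF _ hd),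
        Finset.mem_coe]
  · rintro ⟨q, d⟩ hx ⟨q', d'⟩ hx' h
    simp only [Finset.mem_coe, Finset.mem_sigma, smallRootForests, Finset.mem_filter,
      Finset.mem_univ, true_and] at hx hx'
    obtain ⟨rfl, rfl⟩ := graft_injective hx.1.1 (hF _ hx.2) hx'.1.1 (hF _ hx'.2) h
    rfl

omit [Fintype V] in
theorem prod_max_card_filter_gt (D : Finset V) :
    ∏ v ∈ D, max 1 (D.filter (v < ·)).card = (D.card - 1)! := by
  induction D using Finset.induction_on_min with
  | empty => rfl
  | insert a s ha ih =>
    have has : a ∉ s := fun h => lt_irrefl a (ha a h)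
    have h1 : ∀ v ∈ s, max 1 ((insert a s).filter (v < ·)).card = max 1 (s.filter (v < ·)).card := by
      intro v hv
      rw [Finset.filter_insert, if_neg (ha v hv).not_gt]
    rw [Finset.prod_insert has, Finset.prod_congr rfl h1, ih, Finset.card_insert_of_notMem has,
      Finset.filter_insert, if_neg (lt_irrefl a), Finset.filter_true_of_mem ha, Nat.add_sub_cancel]
    cases hs : s.card with
    | zero => simp
    | succ m => simp [Nat.factorial_succ]

theorem card_decreasingTrees (D : Finset V) : (decreasingTrees D).card = (D.card - 1)! := by
  classical
  have h1 : decreasingTrees D = Fintype.piFinset fun v => if v ∈ D then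
      (if D.filter (v < ·) = ∅ then {none} else (D.filter (v < ·)).map Function.Embedding.some)
      else {none} := by
    ext d
    rw [mem_decreasingTrees, Fintype.mem_piFinset]
    constructor
    · intro h v
      cases hv : d v with
      | none =>
        split_ifs with h1 h2
        · simp
        · obtain ⟨w, hw⟩ := Finset.nonempty_iff_ne_empty.2 h2
          rw [Finset.mem_filter] at hw
          exact absurd hv (h.2 v h1 w hw.1 hw.2)
        · simp
      | some u =>
        have h2 := h.1 u v hv
        have hmem : u ∈ D.filter (v < ·) := Finset.mem_filter.2 h2.2
        rw [if_pos h2.1, if_neg (Finset.ne_empty_of_mem hmem)]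
        exact Finset.mem_map.2 ⟨u, hmem, rfl⟩
    · intro h
      constructor
      · intro u v hvu
        have := h v
        rw [hvu] at this
        split_ifs at this with h1 h2
        · simp at this
        · rw [Finset.mem_map] at this
          obtain ⟨w, hw, hwu⟩ := this
          obtain rfl : w = u := Option.some_injective _ hwu
          exact ⟨h1, Finset.mem_filter.1 hw⟩
        · simp at this
      · intro v hv w hw hvw hnone
        have := h v
        rw [hnone, if_pos hv, if_neg (Finset.ne_empty_of_mem (Finset.mem_filter.2 ⟨hw, hvw⟩)),
          Finset.mem_map] at this
        obtain ⟨x, -, hx⟩ := this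
        exact Option.some_ne_none _ hx
  rw [h1, Fintype.card_piFinset, ← prod_max_card_filter_gt, ← Finset.prod_subset
    (Finset.subset_univ D)]
  · refine Finset.prod_congr rfl fun v hv => ?_
    rw [if_pos hv]
    split_ifs with h2
    · simp [h2]
    · rw [Finset.card_map, max_eq_right]
      exact Finset.card_pos.2 (Finset.nonempty_iff_ne_empty.2 h2)
  · intro v _ hv
    simp [hv]

open Classical in
/-- The parent functions of the decreasing chains on `D`. -/
noncomputable def decreasingChains (D : Finset V) : Finset (V → Option V) :=
  (decreasingTrees D).filter fun d => ∀ a b u, d a = some u → d b = some u → a = b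

theorem mem_decreasingChains {D : Finset V} {d : V → Option V} :
    d ∈ decreasingChains D ↔
      d ∈ decreasingTrees D ∧ ∀ a b u, d a = some u → d b = some u → a = b := by
  simp [decreasingChains]

open Classical in
/-- The only decreasing chain on `D` maps each element to the next larger one. -/
theorem card_decreasingChains (D : Finset V) : (decreasingChains D).card = 1 := by
  have hnext : ∀ d ∈ decreasingTrees D, (∀ a b u, d a = some u → d b = some u → a = b) →
      ∀ v u, d v = some u → ∀ x ∈ D, v < x → u ≤ x := by
    intro d hd hinj v
    rw [mem_decreasingTrees] at hd
    induction v using WellFoundedGT.induction with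
    | ind v ih =>
      intro u hu x hx hvx
      by_contra hxu
      push Not at hxu
      -- the element `w` before `u` is also mapped to `u`
      have hne : (D.filter (· < u)).Nonempty := ⟨x, Finset.mem_filter.2 ⟨hx, hxu⟩⟩
      set w := (D.filter (· < u)).max' hne with hwdef
      have hw := Finset.mem_filter.1 ((D.filter (· < u)).max'_mem hne)
      rw [← hwdef] at hw
      have hxw : x ≤ w := Finset.le_max' _ x (Finset.mem_filter.2 ⟨hx, hxu⟩)
      have hvw : v < w := hvx.trans_le hxw
      have huD := (hd.1 u v hu).2.1
      obtain ⟨y, hy⟩ := Option.ne_none_iff_exists'.1 (hd.2 w hw.1 u huD hw.2)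
      have hyu : y ≤ u := ih w hvw y hy u huD hw.2
      have hwy := hd.1 y w hy
      have huy : u ≤ y := by
        by_contra h
        push Not at h
        exact (Finset.le_max' _ y (Finset.mem_filter.2 ⟨hwy.2.1, h⟩)).not_gt hwy.2.2
      obtain rfl := le_antisymm hyu huy
      exact hvw.ne (hinj v w _ hu hy)
  rw [Finset.card_eq_one]
  let d₀ : V → Option V := fun v => if h : v ∈ D ∧ (D.filter (v < ·)).Nonempty then
    some ((D.filter (v < ·)).min' h.2) else none
  have hd₀ : ∀ {v u}, d₀ v = some u →
      v ∈ D ∧ (u ∈ D ∧ v < u) ∧ ∀ x ∈ D, v < x → u ≤ x := by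
    intro v u h
    simp only [d₀] at h
    split_ifs at h with h1
    obtain rfl := Option.some_inj.1 h
    exact ⟨h1.1, Finset.mem_filter.1 ((D.filter (v < ·)).min'_mem h1.2), fun x hx hvx =>
      Finset.min'_le _ x (Finset.mem_filter.2 ⟨hx, hvx⟩)⟩
  have hmem : d₀ ∈ decreasingTrees D := by
    rw [mem_decreasingTrees]
    refine ⟨fun u v h => ⟨(hd₀ h).1, (hd₀ h).2.1⟩, fun v hv w hw hvw => ?_⟩
    simp only [d₀]
    rw [dif_pos ⟨hv, ⟨w, Finset.mem_filter.2 ⟨hw, hvw⟩⟩⟩]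
    exact Option.some_ne_none _
  refine ⟨d₀, Finset.eq_singleton_iff_unique_mem.2 ⟨?_, ?_⟩⟩
  · refine mem_decreasingChains.2 ⟨hmem, fun a b u ha hb => ?_⟩
    have ha' := hd₀ ha
    have hb' := hd₀ hb
    rcases lt_trichotomy a b with h | h | h
    · exact absurd (ha'.2.2 b hb'.1 h) hb'.2.1.2.not_ge
    · exact h
    · exact absurd (hb'.2.2 a ha'.1 h) ha'.2.1.2.not_ge
  · intro d hd
    rw [mem_decreasingChains] at hd
    have hn := hnext d hd.1 hd.2
    rw [mem_decreasingTrees] at hd hmem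
    funext v
    cases hv : d v with
    | none =>
      symm
      refine Option.eq_none_iff_forall_ne_some.2 fun u hu => ?_
      have := hd₀ hu
      exact hd.1.2 v this.1 u this.2.1.1 this.2.1.2 hv
    | some u =>
      have h1 := hd.1.1 u v hv
      obtain ⟨y, hy⟩ := Option.ne_none_iff_exists'.1 (hmem.2 v h1.1 u h1.2.1 h1.2.2)
      have h2 := hd₀ hy
      rw [hy, le_antisymm (hn v u hv y h2.2.1.1 h2.2.1.2) (h2.2.2 u h1.2.1 h1.2.2)]

end Decreasing

theorem ncard_treesMD (n k : ℕ) :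
    (treesMD n k).ncard = (smallRootForests (Fin (n + 1)) (k + 1)).card * k ! := by
  refine ncard_eq_of_forall_mem_iff (by omega) decreasingTrees (fun _ => subset_rfl)
    (fun D hD => by rw [card_decreasingTrees, hD, Nat.add_sub_cancel]) _ (fun T hT => hT) ?_
  intro T q d _ hmd hcard hd
  refine iff_of_true ?_ hd
  rw [treesMD, Set.mem_ofPred_eq, hmd, Set.ncard_coe_finset, hcard]

theorem ncard_treesMDChain (n k : ℕ) (hk : 1 ≤ k) :
    (treesMDChain n k).ncard = (smallRootForests (Fin n) k).card := by
  rw [← mul_one (smallRootForests (Fin n) k).card]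
  refine ncard_eq_of_forall_mem_iff hk decreasingChains
    (fun D _ hd => (mem_decreasingChains.1 hd).1) (fun D _ => card_decreasingChains D) _ (fun T hT => hT.2) ?_
  intro T q d hg hmd hcard hd
  have hchild : ∀ a ∈ rootSet q, ∀ v, T.IsChild v a ↔ d a = some v := by
    intro a ha v
    rw [← LabeledRootedTree.parent_eq_some, hg, graft_of_mem ha]
  have hdD := (mem_decreasingTrees.1 hd).1
  rw [mem_decreasingChains, treesMDChain, Set.mem_ofPred_eq, LabeledRootedTree.MDIsChain, hmd,
    Set.ncard_coe_finset]
  constructor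
  · rintro ⟨h, -⟩
    refine ⟨hd, fun a b u ha hb => ?_⟩
    have ha' := hdD u a ha
    have hb' := hdD u b hb
    exact h u ha'.2.1 a ha'.1 b hb'.1 ((hchild a ha'.1 u).2 ha) ((hchild b hb'.1 u).2 hb)
  · rintro ⟨-, h⟩
    exact ⟨fun v _ a ha b hb hva hvb => h a b v ((hchild a ha v).1 hva) ((hchild b hb v).1 hvb),
      hcard⟩

/-! ### Prime parking functions -/

section FirstBlock

variable {ι : Type*} [DecidableEq ι]

/-- `L` is the first block of `f` on `S`, where the letters are counted from `c + 1`: its letters are at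
most `c + |L|`, all other letters are larger, and for `1 ≤ i < |L|` more than `i` letters are at most
`c + i`. -/
structure IsFirstBlock (S : Finset ι) (f : ι → ℕ) (c : ℕ) (L : Finset ι) : Prop where
  subset : L ⊆ S
  nonempty : L.Nonempty
  le_of_mem : ∀ x ∈ L, f x ≤ c + L.card
  lt_of_notMem : ∀ x ∈ S, x ∉ L → c + L.card < f x
  lt_card : ∀ i, 1 ≤ i → i < L.card → i < (S.filter (f · ≤ c + i)).card

namespace IsFirstBlock

variable {S : Finset ι} {f : ι → ℕ} {c : ℕ} {L L' : Finset ι}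

theorem eq_filter (h : IsFirstBlock S f c L) : L = S.filter (f · ≤ c + L.card) := by
  ext x
  rw [Finset.mem_filter]
  constructor
  · exact fun hx => ⟨h.subset hx, h.le_of_mem x hx⟩
  · rintro ⟨hx, hle⟩
    by_contra hxL
    exact (h.lt_of_notMem x hx hxL).not_ge hle

theorem card_le (h : IsFirstBlock S f c L) (h' : IsFirstBlock S f c L') : L.card ≤ L'.card := by
  by_contra hlt
  push Not at hlt
  have h1 := h.lt_card L'.card (Finset.card_pos.2 h'.nonempty) hlt
  rw [← h'.eq_filter] at h1
  exact lt_irrefl _ h1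

theorem unique (h : IsFirstBlock S f c L) (h' : IsFirstBlock S f c L') : L = L' := by
  rw [h.eq_filter, h'.eq_filter, le_antisymm (h.card_le h') (h'.card_le h)]

omit [DecidableEq ι] in
/-- The size of the first block is the least `j ≥ 1` for which at most `j` letters are at most
`c + j`. -/
theorem exists_of_mem {S : Finset ι} {f : ι → ℕ} {c : ℕ} {x : ι} (hx : x ∈ S) (hfx : f x ≤ c + 1) :
    ∃ L, IsFirstBlock S f c L := by
  have hex : ∃ j, 1 ≤ j ∧ (S.filter (f · ≤ c + j)).card ≤ j :=
    ⟨S.card, Finset.card_pos.2 ⟨x, hx⟩, Finset.card_filter_le _ _⟩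
  classical
  set j := Nat.find hex with hj
  obtain ⟨hj1, hj2⟩ := Nat.find_spec hex
  rw [← hj] at hj1 hj2
  have hlt : ∀ i, 1 ≤ i → i < j → i < (S.filter (f · ≤ c + i)).card := by
    intro i hi hij
    have := Nat.find_min hex hij
    push Not at this
    exact this hi
  have hcard : (S.filter (f · ≤ c + j)).card = j := by
    refine le_antisymm hj2 ?_
    rcases Nat.lt_or_ge 1 j with h | h
    · have h1 := hlt (j - 1) (by omega) (by omega)
      have h2 : S.filter (f · ≤ c + (j - 1)) ⊆ S.filter (f · ≤ c + j) :=
        Finset.monotone_filter_right S fun y _ hy => hy.trans (by omega)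
      have := Finset.card_le_card h2
      omega
    · have h1 : j = 1 := le_antisymm h hj1
      rw [h1]
      exact Finset.card_pos.2 ⟨x, Finset.mem_filter.2 ⟨hx, hfx⟩⟩
  refine ⟨S.filter (f · ≤ c + j), Finset.filter_subset _ _, ?_, ?_, ?_, ?_⟩
  · exact Finset.card_pos.1 (by omega)
  · intro y hy
    rw [hcard]
    exact (Finset.mem_filter.1 hy).2
  · intro y hy hyn
    rw [hcard]
    by_contra h
    exact hyn (Finset.mem_filter.2 ⟨hy, not_lt.1 h⟩)
  · rwa [hcard]

end IsFirstBlock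

end FirstBlock

section PrimeFunctions

/-- `f` is a prime parking function, by the numbers of its letters that are at most `j`. -/
def IsPrimeFun {ι : Type*} [Fintype ι] (f : ι → ℕ) : Prop :=
  ∀ j, 1 ≤ j → min (Fintype.card ι) (j + 1) ≤ (Finset.univ.filter (f · ≤ j)).card

open Classical in
/-- The prime parking functions with positions in `ι`. -/
noncomputable def primeFuns (ι : Type*) [Fintype ι] : Finset (ι → ℕ) :=
  (Fintype.piFinset fun _ => Finset.Icc 1 (Fintype.card ι)).filter IsPrimeFun

theorem IsPrimeFun.le_card {ι : Type*} [Fintype ι] {f : ι → ℕ} (hf : IsPrimeFun f) (i : ι) :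
    f i ≤ Fintype.card ι := by
  have hpos : 0 < Fintype.card ι := Fintype.card_pos_iff.2 ⟨i⟩
  have h1 := hf (Fintype.card ι) hpos
  rw [min_eq_left (by omega)] at h1
  have h2 := Finset.eq_univ_of_card _ (le_antisymm (Finset.card_le_univ _) h1)
  have h3 := Finset.mem_univ i
  rw [← h2, Finset.mem_filter] at h3
  exact h3.2

theorem mem_primeFuns {ι : Type*} [Fintype ι] {f : ι → ℕ} :
    f ∈ primeFuns ι ↔ (∀ i, 1 ≤ f i) ∧ IsPrimeFun f := by
  simp only [primeFuns, Finset.mem_filter, Fintype.mem_piFinset, Finset.mem_Icc]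
  exact ⟨fun h => ⟨fun i => (h.1 i).1, h.2⟩, fun h => ⟨fun i => ⟨h.1 i, h.2.le_card i⟩, h.2⟩⟩

theorem card_filter_subtype_mem {ι : Type*} (L : Finset ι) (P : ι → Prop) [DecidablePred P] :
    (Finset.univ.filter fun i : {x // x ∈ L} => P i).card = (L.filter P).card := by
  rw [← Finset.card_map (Function.Embedding.subtype _)]
  congr 1
  ext x
  simp [and_comm]

variable {ι : Type*} [Fintype ι] [DecidableEq ι]

theorem isFirstBlock_univ_iff {f : ι → ℕ} {L : Finset ι} (hL : L.Nonempty) :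
    IsFirstBlock Finset.univ f 0 L ↔
      IsPrimeFun (fun i : {x // x ∈ L} => f i) ∧ ∀ x, x ∉ L → L.card < f x := by
  constructor
  · intro h
    refine ⟨fun j hj => ?_, fun x hx => by simpa using h.lt_of_notMem x (Finset.mem_univ x) hx⟩
    rw [card_filter_subtype_mem L (f · ≤ j), Fintype.card_coe]
    rcases Nat.lt_or_ge j L.card with hlt | hge
    · rw [min_eq_right (by omega)]
      have h1 := h.lt_card j hj hlt
      rw [zero_add] at h1
      refine Nat.succ_le_of_lt (h1.trans_le (Finset.card_le_card fun x hx => ?_))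
      rw [Finset.mem_filter] at hx ⊢
      refine ⟨?_, hx.2⟩
      by_contra hxL
      have := h.lt_of_notMem x (Finset.mem_univ x) hxL
      omega
    · rw [min_eq_left (by omega), Finset.filter_true_of_mem]
      intro x hx
      have := h.le_of_mem x hx
      omega
  · rintro ⟨h1, h2⟩
    refine ⟨Finset.subset_univ L, hL, fun x hx => ?_, fun x _ hx => by simpa using h2 x hx,
      fun i hi hlt => ?_⟩
    · simpa using h1.le_card ⟨x, hx⟩
    · have h3 := h1 i hi
      rw [card_filter_subtype_mem L (f · ≤ i), Fintype.card_coe, min_eq_right (by omega)] at h3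
      rw [zero_add]
      exact (Nat.lt_of_succ_le h3).trans_le
        (Finset.card_le_card (Finset.filter_subset_filter _ (Finset.subset_univ L)))

open Classical in
/-- The words with first block `L` are pairs of a prime parking function on `L` and a word in the letters
`|L| + 1, …, N` off `L`. -/
theorem card_filter_isFirstBlock {L : Finset ι} (hL : L.Nonempty) (N : ℕ) (hN : L.card ≤ N) :
    ((Fintype.piFinset fun _ : ι => Finset.Icc 1 N).filter
      fun f => IsFirstBlock Finset.univ f 0 L).card =
      (primeFuns {x // x ∈ L}).card * (N - L.card) ^ (Fintype.card ι - L.card) := by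
  have h1 : (primeFuns {x // x ∈ L}).card * (N - L.card) ^ (Fintype.card ι - L.card) =
      (primeFuns {x // x ∈ L} ×ˢ
        Fintype.piFinset fun _ : {x // x ∉ L} => Finset.Ioc L.card N).card := by
    rw [Finset.card_product, Fintype.card_piFinset, Finset.prod_const, Nat.card_Ioc,
      Finset.card_univ, Fintype.card_subtype_compl, Fintype.card_coe]
  rw [h1]
  refine Finset.card_nbij' (fun f => (fun i => f i, fun i => f i))
    (fun x i => if h : i ∈ L then x.1 ⟨i, h⟩ else x.2 ⟨i, h⟩) ?_ ?_ ?_ ?_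
  · intro f hf
    simp only [Finset.coe_filter, Set.mem_ofPred_eq, Fintype.mem_piFinset, Finset.mem_Icc,
      isFirstBlock_univ_iff hL] at hf
    simp only [Finset.coe_product, Set.mem_prod, Finset.mem_coe, mem_primeFuns,
      Fintype.mem_piFinset, Finset.mem_Ioc]
    exact ⟨⟨fun i => (hf.1 i).1, hf.2.1⟩, fun i => ⟨hf.2.2 i i.2, (hf.1 i).2⟩⟩
  · rintro ⟨g, h⟩ hx
    simp only [Finset.coe_product, Set.mem_prod, Finset.mem_coe, mem_primeFuns,
      Fintype.mem_piFinset, Finset.mem_Ioc] at hx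
    simp only [Finset.coe_filter, Set.mem_ofPred_eq, Fintype.mem_piFinset, Finset.mem_Icc,
      isFirstBlock_univ_iff hL]
    refine ⟨fun i => ?_, ?_, fun i hi => ?_⟩
    · split_ifs with hi
      · have := hx.1.2.le_card ⟨i, hi⟩
        rw [Fintype.card_coe] at this
        exact ⟨hx.1.1 _, this.trans hN⟩
      · exact ⟨by have := (hx.2 ⟨i, hi⟩).1; omega, (hx.2 ⟨i, hi⟩).2⟩
    · convert hx.1.2 using 2 with i
      simp
    · rw [dif_neg hi]
      exact (hx.2 ⟨i, hi⟩).1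
  · intro f _
    funext i
    by_cases hi : i ∈ L <;> simp [hi]
  · rintro ⟨g, h⟩ _
    refine Prod.ext ?_ ?_
    · funext i
      simp
    · funext i
      simp [i.2]

open Classical in
theorem filter_isFirstBlock_univ [Nonempty ι] :
    (Fintype.piFinset fun _ : ι => Finset.Icc 1 (Fintype.card ι)).filter
      (fun f => IsFirstBlock Finset.univ f 0 Finset.univ) = primeFuns ι := by
  unfold primeFuns
  ext f
  simp only [Finset.mem_filter, Fintype.mem_piFinset]
  refine and_congr_right fun _ => ?_
  rw [isFirstBlock_univ_iff Finset.univ_nonempty, and_iff_left (by simp)]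
  refine forall₂_congr fun j _ => ?_
  rw [card_filter_subtype_mem Finset.univ (f · ≤ j), Fintype.card_coe, Finset.card_univ]

open Classical in
/-- A word has no letter `1`, or it is determined by its first block `L`, a prime parking function on
`L`, and a word with letters larger than `|L|` off `L`. -/
theorem card_pow_card_eq_sum_isFirstBlock :
    Fintype.card ι ^ Fintype.card ι = (Fintype.card ι - 1) ^ Fintype.card ι +
      ∑ L ∈ (Finset.univ : Finset ι).powerset.erase ∅,
        ((Fintype.piFinset fun _ : ι => Finset.Icc 1 (Fintype.card ι)).filter
          fun f => IsFirstBlock Finset.univ f 0 L).card := by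
  set W := Fintype.piFinset fun _ : ι => Finset.Icc 1 (Fintype.card ι) with hW
  have h1 : W.card = Fintype.card ι ^ Fintype.card ι := by
    rw [hW, Fintype.card_piFinset, Finset.prod_const, Nat.card_Icc, Finset.card_univ,
      Nat.add_sub_cancel]
  have h2 : (W.filter fun f => ∀ x, f x ≠ 1).card = (Fintype.card ι - 1) ^ Fintype.card ι := by
    have : W.filter (fun f => ∀ x, f x ≠ 1) =
        Fintype.piFinset fun _ : ι => Finset.Icc 2 (Fintype.card ι) := by
      ext f
      simp only [hW, Finset.mem_filter, Fintype.mem_piFinset, Finset.mem_Icc]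
      constructor
      · intro h x
        have h1 := h.1 x
        have h2 := h.2 x
        omega
      · intro h
        refine ⟨fun x => ?_, fun x => ?_⟩ <;>
        · have := h x
          omega
    rw [this, Fintype.card_piFinset, Finset.prod_const, Nat.card_Icc, Finset.card_univ]
    congr 1
  rw [← h1, ← h2, ← Finset.card_filter_add_card_filter_not (s := W) (fun f => ∀ x, f x ≠ 1)]
  congr 1
  rw [← Finset.card_biUnion]
  · congr 1
    ext f
    simp only [Finset.mem_filter, Finset.mem_biUnion, Finset.mem_erase, Finset.mem_powerset]
    constructor
    · rintro ⟨hf, hx⟩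
      push Not at hx
      obtain ⟨x, hx⟩ := hx
      obtain ⟨L, hL⟩ := IsFirstBlock.exists_of_mem (f := f) (c := 0) (Finset.mem_univ x) (by omega)
      exact ⟨L, ⟨hL.nonempty.ne_empty, hL.subset⟩, hf, hL⟩
    · rintro ⟨L, ⟨hL0, -⟩, hf, hL⟩
      refine ⟨hf, fun hne => ?_⟩
      have h3 : ∀ x, 2 ≤ f x := by
        intro x
        have h4 := Fintype.mem_piFinset.1 hf x
        rw [Finset.mem_Icc] at h4
        have := hne x
        omega
      obtain ⟨x, hx⟩ := hL.nonempty
      have h4 := hL.le_of_mem x hx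
      have h5 := h3 x
      have h6 := hL.lt_card 1 le_rfl (by omega)
      rw [Finset.filter_false_of_mem, Finset.card_empty] at h6
      · omega
      · intro y _
        have := h3 y
        omega
  · intro L _ L' _ hne
    rw [Function.onFun, Finset.disjoint_left]
    intro f hf hf'
    exact hne ((Finset.mem_filter.1 hf).2.unique (Finset.mem_filter.1 hf').2)

/-- Abel's identity at `α = -1`. -/
theorem pow_self_eq_add_sum_range (n : ℕ) (hn : 1 ≤ n) :
    n ^ n = (n - 1) ^ n +
      ∑ l ∈ (Finset.range (n + 1)).erase 0, n.choose l * ((l - 1) ^ (l - 1) * (n - l) ^ (n - l)) := by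
  have h := sum_choose_mul_abelVal (-1) n
  rw [← Finset.sum_range_reflect, Nat.add_sub_cancel] at h
  have h0 : (0 : ℕ) ∈ Finset.range (n + 1) := by simp
  rw [← Finset.add_sum_erase _ _ h0] at h
  have h1 : ∀ l ∈ (Finset.range (n + 1)).erase 0,
      (n.choose (n - l) : ℚ) * ((n - l : ℕ) : ℚ) ^ (n - l) * abelVal (-1) (n - (n - l)) =
      -((n.choose l * ((l - 1) ^ (l - 1) * (n - l) ^ (n - l)) : ℕ) : ℚ) := by
    intro l hl
    rw [Finset.mem_erase, Finset.mem_range] at hl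
    obtain ⟨m, rfl⟩ : ∃ m, l = m + 1 := ⟨l - 1, by omega⟩
    rw [Nat.choose_symm (by omega), show n - (n - (m + 1)) = m + 1 by omega, abelVal,
      Nat.add_sub_cancel]
    push_cast
    ring
  rw [Finset.sum_congr rfl h1, Finset.sum_neg_distrib, ← Nat.cast_sum] at h
  simp only [Nat.sub_zero, Nat.sub_self, Nat.choose_self, abelVal, Nat.cast_one, one_mul,
    mul_one] at h
  rw [show (-1 : ℚ) + n = ((n - 1 : ℕ) : ℚ) by rw [Nat.cast_sub hn]; push_cast; ring] at h
  have h2 : ((n ^ n : ℕ) : ℚ) = (((n - 1) ^ n +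
      ∑ l ∈ (Finset.range (n + 1)).erase 0,
        n.choose l * ((l - 1) ^ (l - 1) * (n - l) ^ (n - l)) : ℕ) : ℚ) := by
    rw [Nat.cast_add, Nat.cast_pow, Nat.cast_pow]
    linear_combination h
  exact_mod_cast h2

theorem card_primeFuns (ι : Type*) [Fintype ι] :
    (primeFuns ι).card = (Fintype.card ι - 1) ^ (Fintype.card ι - 1) := by
  classical
  induction hn : Fintype.card ι using Nat.strong_induction_on generalizing ι with
  | _ n ih =>
    rcases Nat.eq_zero_or_pos n with rfl | hpos
    · have := Fintype.card_eq_zero_iff.1 hn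
      rw [Finset.card_eq_one.2 ⟨fun _ => 0, ?_⟩]
      · simp
      refine Finset.eq_singleton_iff_unique_mem.2 ⟨mem_primeFuns.2 ⟨isEmptyElim, fun j _ => ?_⟩,
        fun f _ => Subsingleton.elim _ _⟩
      simp
    · have hne : Nonempty ι := Fintype.card_pos_iff.1 (by omega)
      let wt : ℕ → ℕ := fun l => (l - 1) ^ (l - 1) * (n - l) ^ (n - l)
      have h1 := card_pow_card_eq_sum_isFirstBlock (ι := ι)
      have h2 := Finset.sum_powerset_apply_card (x := (Finset.univ : Finset ι)) wt
      have h3 : n ^ n = (n - 1) ^ n + ∑ l ∈ (Finset.range (n + 1)).erase 0, n.choose l * wt l :=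
        pow_self_eq_add_sum_range n hpos
      have hu : (Finset.univ : Finset ι) ∈ (Finset.univ : Finset ι).powerset.erase ∅ :=
        Finset.mem_erase.2 ⟨Finset.univ_nonempty.ne_empty, Finset.mem_powerset_self _⟩
      rw [Finset.card_univ, hn, ← Finset.add_sum_erase _ _ (Finset.empty_mem_powerset _),
        ← Finset.add_sum_erase (Finset.range (n + 1)) _ (by simp : 0 ∈ Finset.range (n + 1))] at h2
      simp only [Finset.card_empty, Nat.choose_zero_right, smul_eq_mul, one_mul,
        Nat.add_left_cancel_iff] at h2
      rw [← h2, ← Finset.add_sum_erase _ _ hu] at h3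
      have h4 : ∀ L ∈ ((Finset.univ : Finset ι).powerset.erase ∅).erase Finset.univ,
          ((Fintype.piFinset fun _ : ι => Finset.Icc 1 (Fintype.card ι)).filter
            fun f => IsFirstBlock Finset.univ f 0 L).card = wt L.card := by
        intro L hL
        rw [Finset.mem_erase, Finset.mem_erase] at hL
        have hlt : L.card < n := by
          rw [← hn]
          exact (Finset.card_lt_iff_ne_univ L).2 hL.1
        rw [card_filter_isFirstBlock (Finset.nonempty_iff_ne_empty.2 hL.2.1) _ (by omega),
          ih L.card hlt _ (Fintype.card_coe L), hn]
      rw [← Finset.add_sum_erase _ _ hu, filter_isFirstBlock_univ, Finset.sum_congr rfl h4, hn, h3,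
        Finset.card_univ, hn] at h1
      have h5 : wt n = (n - 1) ^ (n - 1) := by simp [wt]
      rw [h5] at h1
      omega

end PrimeFunctions

section PrimeWords

theorem getElem_le_iff_lt_countP {l : List ℕ+} (hl : l.Pairwise (· ≤ ·)) (j i : ℕ)
    (hi : i < l.length) : ((l[i] : ℕ+) : ℕ) ≤ j ↔ i < l.countP fun x : ℕ+ => (x : ℕ) ≤ j := by
  induction l generalizing i with
  | nil => simp at hi
  | cons a l ih =>
    rw [List.pairwise_cons] at hl
    by_cases ha : (a : ℕ) ≤ j
    · rw [List.countP_cons_of_pos (by simpa using ha)]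
      cases i with
      | zero => simpa using ha
      | succ i =>
        rw [List.getElem_cons_succ, ih hl.2]
        omega
    · have h0 : (a :: l).countP (fun x : ℕ+ => (x : ℕ) ≤ j) = 0 := by
        rw [List.countP_eq_zero]
        intro x hx
        rw [List.mem_cons] at hx
        rcases hx with rfl | hx
        · simpa using ha
        · have h1 : (a : ℕ) ≤ x := hl.1 x hx
          simp only [decide_eq_true_eq]
          omega
      rw [h0]
      refine iff_of_false ?_ (by omega)
      have h1 : (a : ℕ) ≤ ((a :: l)[i] : ℕ+) := by
        cases i with
        | zero => simp
        | succ i => exact hl.1 _ (List.getElem_mem _)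
      omega

/-- Prime parking functions in terms of the numbers of letters that are at most `j`: the minimum with
the length covers words of length `1`, and makes the condition void for the empty word. -/
theorem isPrimeParking_iff (w : PosWord) :
    IsPrimeParking w ↔ ∀ j, 1 ≤ j → min w.length (j + 1) ≤ w.countP fun x : ℕ+ => (x : ℕ) ≤ j := by
  have hperm : w.rearr.Perm w := List.perm_insertionSort _ _
  have hsort : w.rearr.Pairwise (· ≤ ·) := List.pairwise_insertionSort _ _
  have hlen : w.rearr.length = w.length := hperm.length_eq
  have hcount : ∀ j, w.rearr.countP (fun x : ℕ+ => (x : ℕ) ≤ j) = w.countP fun x : ℕ+ => (x : ℕ) ≤ j :=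
    fun j => hperm.countP_eq _
  constructor
  · rintro ⟨h1, h2⟩ j hj
    rcases Nat.eq_zero_or_pos w.length with h0 | hpos
    · simp [h0]
    · rcases Nat.lt_or_ge j w.length with hlt | hge
      · have h3 := h2 j (by omega) hj
        have h4 := (getElem_le_iff_lt_countP hsort j j (by omega)).1 (by omega)
        rw [hcount] at h4
        omega
      · -- all letters are at most `j`, as the largest one is
        have h3 : ((w.rearr[w.length - 1]'(by omega) : ℕ+) : ℕ) ≤ j := by
          have := h1 (w.length - 1) (by omega)
          omega
        have h4 := (getElem_le_iff_lt_countP hsort j _ (by omega)).1 h3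
        rw [hcount] at h4
        omega
  · intro h
    have key : ∀ i (hi : i < w.rearr.length), 1 ≤ i → ((w.rearr[i] : ℕ+) : ℕ) < i + 1 := by
      intro i hi h1
      have h2 := h i h1
      rw [Nat.lt_succ_iff, getElem_le_iff_lt_countP hsort, hcount]
      omega
    refine ⟨fun i hi => ?_, key⟩
    rcases Nat.eq_zero_or_pos i with rfl | hpos
    · have h2 := h 1 le_rfl
      rw [zero_add, getElem_le_iff_lt_countP hsort, hcount]
      omega
    · exact (key i hi hpos).le

theorem countP_ofFn {m : ℕ} (f : Fin m → ℕ+) (j : ℕ) :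
    (List.ofFn f).countP (fun x : ℕ+ => (x : ℕ) ≤ j) =
      (Finset.univ.filter fun i => (f i : ℕ) ≤ j).card := by
  induction m with
  | zero => simp
  | succ m ih =>
    rw [List.ofFn_succ, List.countP_cons, ih, Fin.card_filter_univ_succ, add_comm]
    by_cases h : (f 0 : ℕ) ≤ j <;> simp [h, add_comm]

theorem isPrimeParking_ofFn {m : ℕ} (f : Fin m → ℕ+) :
    IsPrimeParking (List.ofFn f) ↔ IsPrimeFun fun i => (f i : ℕ) := by
  simp only [isPrimeParking_iff, countP_ofFn, List.length_ofFn, IsPrimeFun, Fintype.card_fin]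

/-- The prime parking functions of length `m` as words correspond to those as functions. -/
noncomputable def primeWordEquiv (m : ℕ) :
    {w : PosWord // IsPrimeParking w ∧ w.length = m} ≃ primeFuns (Fin m) := by
  refine Equiv.symm (Equiv.ofBijective (fun f => ⟨List.ofFn fun i =>
    (⟨f.1 i, (mem_primeFuns.1 f.2).1 i⟩ : ℕ+), ?_, List.length_ofFn⟩) ⟨?_, ?_⟩)
  · exact (isPrimeParking_ofFn _).2 (mem_primeFuns.1 f.2).2
  · intro f g h
    have h1 := List.ofFn_injective (congrArg Subtype.val h)
    exact Subtype.ext (funext fun i => congrArg PNat.val (congrFun h1 i))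
  · rintro ⟨w, hw, rfl⟩
    refine ⟨⟨fun i => (w.get i : ℕ), mem_primeFuns.2 ⟨fun i => (w.get i).pos, ?_⟩⟩, ?_⟩
    · rw [← isPrimeParking_ofFn, List.ofFn_get]
      exact hw
    · exact Subtype.ext (List.ofFn_get w)

instance finite_primeWords (m : ℕ) : Finite {w : PosWord // IsPrimeParking w ∧ w.length = m} :=
  Finite.of_equiv _ (primeWordEquiv m).symm

/-- There are `(m - 1) ^ (m - 1)` prime parking functions of length `m`. -/
theorem card_primeWords (m : ℕ) :
    Nat.card {w : PosWord // IsPrimeParking w ∧ w.length = m} = (m - 1) ^ (m - 1) := by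
  rw [Nat.card_congr (primeWordEquiv m), Nat.card_eq_fintype_card, Fintype.card_coe, card_primeFuns,
    Fintype.card_fin]

end PrimeWords

/-! ### Bi-words are determined by their words -/

theorem card_filter_lt_injOn (L : Finset ℕ) : Set.InjOn (fun x => (L.filter (· < x)).card) L := by
  have h : ∀ x ∈ L, ∀ y ∈ L, x < y → (L.filter (· < x)).card < (L.filter (· < y)).card := by
    intro x hx y _ hxy
    refine Finset.card_lt_card (Finset.ssubset_iff_subset_ne.2 ⟨?_, fun heq => ?_⟩)
    · exact Finset.monotone_filter_right L fun z _ hz => lt_trans hz hxy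
    · have h1 : x ∈ L.filter (· < y) := Finset.mem_filter.2 ⟨hx, hxy⟩
      rw [← heq] at h1
      exact lt_irrefl x (Finset.mem_filter.1 h1).2
  intro x hx y hy hxy
  rcases lt_trichotomy x y with h1 | h1 | h1
  · exact absurd hxy (h x hx y hy h1).ne
  · exact h1
  · exact absurd hxy (h y hy x hx h1).ne'

theorem exists_card_filter_lt_eq (L : Finset ℕ) {j : ℕ} (hj : j < L.card) :
    ∃ x ∈ L, (L.filter (· < x)).card = j := by
  have h := Finset.surj_on_of_inj_on_of_card_le (s := L) (t := Finset.range L.card)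
    (fun x _ => (L.filter (· < x)).card)
    (fun x hx => Finset.mem_range.2 (Finset.card_lt_card (Finset.filter_ssubset.2
      ⟨x, hx, lt_irrefl x⟩)))
    (fun x y hx hy hxy => card_filter_lt_injOn L hx hy hxy) (by simp)
  obtain ⟨x, hx, hxj⟩ := h j (Finset.mem_range.2 hj)
  exact ⟨x, hx, hxj.symm⟩

namespace BiWord

variable {n : ℕ}

theorem mem_Icc_of_mem (m : BiWord n) {i x : ℕ} (hx : x ∈ (m.col i).1) : x ∈ Finset.Icc 1 n :=
  (m.cover' x).1 ⟨i, hx⟩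

theorem eq_of_mem_of_mem (m : BiWord n) {i j x : ℕ} (hi : x ∈ (m.col i).1)
    (hj : x ∈ (m.col j).1) : i = j := by
  by_contra h
  exact Finset.disjoint_left.1 (m.disjoint' i j h) hi hj

open Classical in
/-- The letter at position `x`, and `0` if `x` is not a position. -/
noncomputable def letterAt (m : BiWord n) (x : ℕ) : ℕ :=
  if hx : x ∈ Finset.Icc 1 n then (m.letter x hx : ℕ) else 0

theorem letterAt_of_mem (m : BiWord n) {i x : ℕ} (hx : x ∈ (m.col i).1) :
    m.letterAt x = ((m.col i).2[m.rankIn i x]'(m.rankIn_lt i x hx) : ℕ+) + m.offset i := by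
  have hIcc := m.mem_Icc_of_mem hx
  have h : m.colOf x hIcc = i := m.eq_of_mem_of_mem (m.mem_colOf _ _) hx
  rw [letterAt, dif_pos hIcc, letter, PNat.mk_coe]
  subst h
  rfl

theorem letterAt_eq_of_toWord_eq {m m' : BiWord n} (h : m.toWord = m'.toWord) :
    m.letterAt = m'.letterAt := by
  have h1 := List.ofFn_injective h
  funext x
  unfold letterAt
  split_ifs with hx
  · rw [Finset.mem_Icc] at hx
    obtain ⟨y, rfl⟩ : ∃ y, x = y + 1 := ⟨x - 1, by omega⟩
    have h2 := congrFun h1 ⟨y, by omega⟩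
    exact congrArg PNat.val h2
  · rfl

theorem offset_succ (m : BiWord n) (i : ℕ) :
    m.offset (i + 1) = m.offset i + if (m.col i).1 = ∅ then 1 else (m.col i).1.card := by
  rw [offset, Finset.sum_range_succ, offset]

theorem offset_mono (m : BiWord n) : Monotone m.offset :=
  monotone_nat_of_le_succ fun i => by rw [offset_succ]; omega

theorem offset_lt_letterAt (m : BiWord n) {i x : ℕ} (hx : x ∈ (m.col i).1) :
    m.offset i < m.letterAt x := by
  rw [m.letterAt_of_mem hx]
  have := ((m.col i).2[m.rankIn i x]'(m.rankIn_lt i x hx)).pos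
  omega

/-- The set of the positions not occurring in the columns before column `i`. -/
def remaining (m : BiWord n) (i : ℕ) : Finset ℕ :=
  (Finset.Icc 1 n).filter fun x => ∀ p ∈ Finset.range i, x ∉ (m.col p).1

theorem offset_succ_lt_letterAt (m : BiWord n) {i x : ℕ} (hx : x ∈ m.remaining i)
    (hxi : x ∉ (m.col i).1) : m.offset (i + 1) < m.letterAt x := by
  rw [remaining, Finset.mem_filter] at hx
  obtain ⟨j, hj⟩ := (m.cover' x).2 hx.1
  have hij : i + 1 ≤ j := by
    by_contra h
    rcases Nat.lt_or_ge j i with h1 | h1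
    · exact hx.2 j (Finset.mem_range.2 h1) hj
    · obtain rfl : j = i := by omega
      exact hxi hj
  exact (m.offset_mono hij).trans_lt (m.offset_lt_letterAt hj)

theorem col_subset_remaining (m : BiWord n) (i : ℕ) : (m.col i).1 ⊆ m.remaining i := by
  intro x hx
  rw [remaining, Finset.mem_filter]
  refine ⟨m.mem_Icc_of_mem hx, fun p hp hxp => ?_⟩
  rw [Finset.mem_range] at hp
  exact hp.ne (m.eq_of_mem_of_mem hxp hx)

/-- The prime parking condition of column `i` in terms of the letters of the word. -/
theorem min_le_card_filter_letterAt (m : BiWord n) (i j : ℕ) (hj : 1 ≤ j) :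
    min (m.col i).1.card (j + 1) ≤
      ((m.col i).1.filter (m.letterAt · ≤ m.offset i + j)).card := by
  have h1 := (isPrimeParking_iff _).1 (m.prime' i) j hj
  rw [m.length'] at h1
  refine h1.trans ?_
  have h2 := countP_ofFn (m.col i).2.get j
  rw [List.ofFn_get] at h2
  rw [h2, ← Finset.card_map Fin.valEmbedding]
  refine (Finset.card_le_card (t := ((m.col i).1.filter
    (m.letterAt · ≤ m.offset i + j)).image (m.rankIn i)) ?_).trans Finset.card_image_le
  intro k hk
  rw [Finset.mem_map] at hk
  obtain ⟨l, hl, rfl⟩ := hk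
  rw [Finset.mem_filter] at hl
  have hlt := l.2.trans_eq (m.length' i)
  obtain ⟨x, hx, hxl⟩ := exists_card_filter_lt_eq _ hlt
  refine Finset.mem_image.2 ⟨x, Finset.mem_filter.2 ⟨hx, ?_⟩, hxl⟩
  rw [m.letterAt_of_mem hx]
  have h3 : m.rankIn i x = l := hxl
  have h4 := hl.2
  rw [List.get_eq_getElem] at h4
  simp only [h3]
  omega

/-- A nonempty column is the first block of the letters not in the earlier columns, counted from its
offset. -/
theorem isFirstBlock_col (m : BiWord n) {i : ℕ} (hi : (m.col i).1.Nonempty) :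
    IsFirstBlock (m.remaining i) m.letterAt (m.offset i) (m.col i).1 where
  subset := m.col_subset_remaining i
  nonempty := hi
  le_of_mem x hx := by
    have h := m.min_le_card_filter_letterAt i _ (Finset.card_pos.2 hi)
    rw [min_eq_left (by omega)] at h
    have h1 := Finset.eq_of_subset_of_card_le (Finset.filter_subset _ _) h
    rw [← h1] at hx
    exact (Finset.mem_filter.1 hx).2
  lt_of_notMem x hx hxi := by
    have h := m.offset_succ_lt_letterAt hx hxi
    rwa [offset_succ, if_neg hi.ne_empty] at h
  lt_card j hj hlt := by
    have h := m.min_le_card_filter_letterAt i j hj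
    rw [min_eq_right (by omega)] at h
    exact (Nat.lt_of_succ_le h).trans_le
      (Finset.card_le_card (Finset.filter_subset_filter _ (m.col_subset_remaining i)))

/-- Column `i` is empty if and only if no remaining letter is the next one. -/
theorem col_eq_empty_iff (m : BiWord n) (i : ℕ) :
    (m.col i).1 = ∅ ↔ ∀ x ∈ m.remaining i, m.offset i + 1 < m.letterAt x := by
  constructor
  · intro h x hx
    have h1 := m.offset_succ_lt_letterAt (i := i) hx (by simp [h])
    rwa [offset_succ, if_pos h] at h1
  · intro h
    by_contra hne
    have hpos := Finset.card_pos.2 (Finset.nonempty_iff_ne_empty.2 hne)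
    have h1 := m.min_le_card_filter_letterAt i 1 le_rfl
    obtain ⟨x, hx⟩ := Finset.card_pos.1 (lt_of_lt_of_le (by omega) h1)
    rw [Finset.mem_filter] at hx
    exact (h x (m.col_subset_remaining i hx.1)).not_ge hx.2

theorem col_fst_eq {m m' : BiWord n} (h : m.letterAt = m'.letterAt) (i : ℕ) :
    (m.col i).1 = (m'.col i).1 := by
  induction i using Nat.strong_induction_on with
  | _ i ih =>
    have hr : m.remaining i = m'.remaining i :=
      Finset.filter_congr fun x _ => forall₂_congr fun p hp => by rw [ih p (Finset.mem_range.1 hp)]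
    have ho : m.offset i = m'.offset i :=
      Finset.sum_congr rfl fun p hp => by rw [ih p (Finset.mem_range.1 hp)]
    by_cases he : (m.col i).1 = ∅
    · have he' := he
      rw [col_eq_empty_iff, hr, ho, h, ← col_eq_empty_iff] at he'
      rw [he, he']
    · have he' := he
      rw [col_eq_empty_iff, hr, ho, h, ← col_eq_empty_iff] at he'
      have h1 := m.isFirstBlock_col (Finset.nonempty_iff_ne_empty.2 he)
      rw [hr, ho, h] at h1
      exact h1.unique (m'.isFirstBlock_col (Finset.nonempty_iff_ne_empty.2 he'))

/-- A bi-word is determined by its word, column by column: the first block of the remaining letters is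
the next nonempty column. -/
theorem toWord_injective : Function.Injective (toWord (n := n)) := by
  intro m m' h
  have hl := letterAt_eq_of_toWord_eq h
  have hcol := col_fst_eq hl
  ext1
  funext i
  refine Prod.ext (hcol i) (List.ext_getElem ?_ fun j hj hj' => ?_)
  · rw [m.length', m'.length', hcol]
  · have hlt := hj
    rw [m.length'] at hlt
    obtain ⟨x, hx, hxj⟩ := exists_card_filter_lt_eq _ hlt
    have hx' := hcol i ▸ hx
    have ho : m.offset i = m'.offset i :=
      Finset.sum_congr rfl fun p _ => by rw [hcol]
    have h1 := congrFun hl x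
    rw [m.letterAt_of_mem hx, m'.letterAt_of_mem hx', ho] at h1
    have h2 : m.rankIn i x = j := hxj
    have h3 : m'.rankIn i x = j := by
      rw [← h2, rankIn, rankIn, hcol]
    simp only [h2, h3] at h1
    exact PNat.eq (Nat.add_right_cancel h1)

theorem range_col_eq_of_mem_orbit {m m' : BiWord n} (h : m' ∈ orbit ⊤ m) :
    Set.range m'.col = Set.range m.col := by
  obtain ⟨⟨g, hg⟩, rfl⟩ := h
  change Set.range (g m).col = _
  induction hg using Subgroup.closure_induction generalizing m with
  | mem g hg =>
    obtain ⟨i, rfl⟩ := hg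
    have h1 : simplePerm ⊤ i m = m.swapCols i := by
      change simpleAct ⊤ i m = _
      rw [simpleAct, if_pos (Or.inl (ENat.natCast_lt_top _))]
    rw [h1]
    exact (Equiv.swap i (i + 1)).surjective.range_comp m.col
  | one => rfl
  | mul g g' _ _ ih ih' => exact (ih (m := g' m)).trans ih'
  | inv g _ ih =>
    have := ih (m := g⁻¹ m)
    rw [← this, ← Equiv.Perm.mul_apply, mul_inv_cancel, Equiv.Perm.one_apply]

end BiWord

/-! ### The vectors `G` -/

namespace RBiWord

variable {n : ℕ}

theorem I_eq_nil (u : RBiWord ⊤ n) : u.I = [] := by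
  rw [List.eq_nil_iff_forall_not_mem]
  intro c hc
  simpa using u.le_card' c hc

theorem mem_append_iff (u : RBiWord ⊤ n) {c : BiColumn} : c ∈ u.I ++ u.lam ↔ c ∈ u.lam := by
  rw [u.I_eq_nil, List.nil_append]

theorem numCols_eq (u : RBiWord ⊤ n) : u.numCols = u.lam.length := by
  rw [numCols, u.I_eq_nil, List.nil_append]

theorem nodup_lam (u : RBiWord ⊤ n) : u.lam.Nodup :=
  u.sorted'.imp fun h heq => by simp [heq] at h

theorem eq_of_mem_of_mem (u : RBiWord ⊤ n) {c d : BiColumn} (hc : c ∈ u.lam) (hd : d ∈ u.lam)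
    {x : ℕ} (hxc : x ∈ c.1) (hxd : x ∈ d.1) : c = d := by
  have hdis := u.disjoint'
  rw [u.I_eq_nil, List.nil_append] at hdis
  have : Std.Symm fun c d : BiColumn => Disjoint c.1 d.1 := ⟨fun _ _ h => h.symm⟩
  by_contra hne
  exact Finset.disjoint_left.1 (hdis.forall hc hd hne) hxc hxd

theorem ext_mem {u v : RBiWord ⊤ n} (h : ∀ c, c ∈ u.lam ↔ c ∈ v.lam) : u = v := by
  refine RBiWord.ext (by rw [u.I_eq_nil, v.I_eq_nil]) ?_
  exact ((List.perm_ext_iff_of_nodup u.nodup_lam v.nodup_lam).2 h).eq_of_pairwise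
    (fun a b _ _ hab hba => absurd (hab.trans hba) (lt_irrefl _)) u.sorted' v.sorted'

theorem mem_lam_iff (u : RBiWord ⊤ n) (c : BiColumn) :
    c ∈ u.lam ↔ c.1.Nonempty ∧ c ∈ Set.range u.toBiWord.col := by
  rw [← u.mem_append_iff]
  constructor
  · intro hc
    refine ⟨u.nonempty' c hc, ?_⟩
    obtain ⟨i, hi, rfl⟩ := List.getElem_of_mem hc
    exact ⟨i, List.getD_eq_getElem _ _ hi⟩
  · rintro ⟨hne, i, rfl⟩
    have hcol : u.toBiWord.col i = (u.I ++ u.lam).getD i (∅, []) := rfl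
    rcases lt_or_ge i (u.I ++ u.lam).length with h | h
    · rw [hcol, List.getD_eq_getElem _ _ h]
      exact List.getElem_mem h
    · rw [hcol, List.getD_eq_default _ _ h] at hne
      simp at hne

theorem G_injective (K : Type*) [Field K] :
    Function.Injective (fun u : RBiWord ⊤ n => u.G K) := by
  intro u v h
  have hset : BiWord.toWord '' BiWord.orbit ⊤ u.toBiWord =
      BiWord.toWord '' BiWord.orbit ⊤ v.toBiWord := by
    have h1 := congrArg Function.support h
    simpa [G, Set.support_indicator, Function.support_const (one_ne_zero (α := K))] using h1
  have hmem : u.toBiWord.toWord ∈ BiWord.toWord '' BiWord.orbit ⊤ v.toBiWord := by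
    rw [← hset]
    exact Set.mem_image_of_mem _ (MulAction.mem_orbit_self _)
  obtain ⟨m, hm, hmu⟩ := hmem
  obtain rfl := BiWord.toWord_injective hmu
  refine ext_mem fun c => ?_
  rw [mem_lam_iff, mem_lam_iff, BiWord.range_col_eq_of_mem_orbit hm]

/-- The columns of an `∞`-bi-word obtained from a set partition and a prime parking function for each
part: the parts are sorted by their smallest elements. -/
noncomputable def columnsOf (Q : Finpartition (Finset.Icc 1 n))
    (M : ∀ q : Q.parts, {w : PosWord // IsPrimeParking w ∧ w.length = q.1.card}) :
    List BiColumn :=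
  (Q.parts.attach.toList.mergeSort fun q q' => decide (q.1.min ≤ q'.1.min)).map
    fun q => (q.1, (M q).1)

section columnsOf

variable {Q : Finpartition (Finset.Icc 1 n)}
  {M : ∀ q : Q.parts, {w : PosWord // IsPrimeParking w ∧ w.length = q.1.card}}

theorem mem_columnsOf {c : BiColumn} :
    c ∈ columnsOf Q M ↔ ∃ h : c.1 ∈ Q.parts, c.2 = (M ⟨c.1, h⟩).1 := by
  simp only [columnsOf, List.mem_map, List.mem_mergeSort, Finset.mem_toList, Finset.mem_attach,
    true_and]
  constructor
  · rintro ⟨q, rfl⟩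
    exact ⟨q.2, rfl⟩
  · rintro ⟨h, h2⟩
    exact ⟨⟨c.1, h⟩, Prod.ext rfl h2.symm⟩

theorem length_columnsOf : (columnsOf Q M).length = Q.parts.card := by
  simp [columnsOf]

theorem pairwise_columnsOf :
    (columnsOf Q M).Pairwise fun c d => c.1.min < d.1.min ∧ Disjoint c.1 d.1 := by
  have h1 := List.pairwise_mergeSort (le := fun q q' : Q.parts => decide (q.1.min ≤ q'.1.min))
    (fun a b c hab hbc => by
      simp only [decide_eq_true_eq] at hab hbc ⊢
      exact hab.trans hbc)
    (fun a b => by simpa using le_total a.1.min b.1.min) Q.parts.attach.toList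
  have h2 : (Q.parts.attach.toList.mergeSort
      fun q q' => decide (q.1.min ≤ q'.1.min)).Nodup :=
    (List.mergeSort_perm _ _).nodup_iff.2 (Finset.nodup_toList _)
  rw [columnsOf, List.pairwise_map]
  refine (h1.and h2).imp fun {q q'} h => ?_
  have hne : q.1 ≠ q'.1 := fun heq => h.2 (Subtype.ext heq)
  have hd : Disjoint q.1 q'.1 := Q.disjoint q.2 q'.2 hne
  refine ⟨lt_of_le_of_ne (by simpa using h.1) fun heq => ?_, hd⟩
  obtain ⟨a, ha⟩ := Finset.min_of_nonempty (Q.nonempty_of_mem_parts q.2)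
  exact Finset.disjoint_left.1 hd (Finset.mem_of_min ha) (Finset.mem_of_min (heq ▸ ha))

end columnsOf

/-- The `∞`-bi-word with given set partition and prime parking functions. -/
noncomputable def ofPartition (Q : Finpartition (Finset.Icc 1 n))
    (M : ∀ q : Q.parts, {w : PosWord // IsPrimeParking w ∧ w.length = q.1.card}) :
    RBiWord ⊤ n where
  I := []
  lam := columnsOf Q M
  prime' c hc := by
    obtain ⟨h, h2⟩ := mem_columnsOf.1 hc
    rw [h2]
    exact (M _).2.1
  length' c hc := by
    obtain ⟨h, h2⟩ := mem_columnsOf.1 hc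
    rw [h2]
    exact (M _).2.2
  le_card' c hc := by simp at hc
  card_lt' c _ := ENat.natCast_lt_top _
  sorted' := pairwise_columnsOf.imp fun h => h.1
  nonempty' c hc := by
    obtain ⟨h, -⟩ := mem_columnsOf.1 hc
    exact Q.nonempty_of_mem_parts h
  disjoint' := pairwise_columnsOf.imp fun h => h.2
  cover' x := by
    constructor
    · rintro ⟨c, hc, hx⟩
      obtain ⟨h, -⟩ := mem_columnsOf.1 hc
      exact Q.subset h hx
    · intro hx
      obtain ⟨q, hq, hxq⟩ := Q.exists_mem hx
      exact ⟨(q, (M ⟨q, hq⟩).1), mem_columnsOf.2 ⟨hq, rfl⟩, hxq⟩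

/-- The set partition underlying an `∞`-bi-word. -/
def partition (u : RBiWord ⊤ n) : Finpartition (Finset.Icc 1 n) :=
  Finpartition.ofExistsUnique (u.lam.map Prod.fst).toFinset
    (by
      intro p hp x hx
      simp only [List.mem_toFinset, List.mem_map] at hp
      obtain ⟨c, hc, rfl⟩ := hp
      exact (u.cover' x).1 ⟨c, u.mem_append_iff.2 hc, hx⟩)
    (by
      intro x hx
      obtain ⟨c, hc, hxc⟩ := (u.cover' x).2 hx
      rw [mem_append_iff] at hc
      refine ⟨c.1, ⟨by simpa using ⟨c.2, hc⟩, hxc⟩, ?_⟩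
      rintro p ⟨hp, hxp⟩
      simp only [List.mem_toFinset, List.mem_map] at hp
      obtain ⟨d, hd, rfl⟩ := hp
      rw [u.eq_of_mem_of_mem hd hc hxp hxc])
    (by
      intro h
      simp only [List.mem_toFinset, List.mem_map] at h
      obtain ⟨c, hc, hc0⟩ := h
      exact (u.nonempty' c (u.mem_append_iff.2 hc)).ne_empty hc0)

theorem mem_partition_parts (u : RBiWord ⊤ n) {q : Finset ℕ} :
    q ∈ u.partition.parts ↔ ∃ c ∈ u.lam, c.1 = q := by
  simp only [partition, Finpartition.ofExistsUnique, List.mem_toFinset, List.mem_map]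

theorem card_partition_parts (u : RBiWord ⊤ n) : u.partition.parts.card = u.numCols := by
  rw [u.numCols_eq, ← List.length_map (f := Prod.fst)]
  refine List.toFinset_card_of_nodup ((List.nodup_map_iff_inj_on u.nodup_lam).2 ?_)
  intro c hc d hd hcd
  obtain ⟨x, hx⟩ := u.nonempty' c (u.mem_append_iff.2 hc)
  exact u.eq_of_mem_of_mem hc hd hx (hcd ▸ hx)

/-- An `∞`-bi-word with `k` columns amounts to a set partition into `k` parts with a prime parking
function for each part. -/
theorem ofPartition_bijective (k : ℕ) : Function.Bijective
    (fun x : (Σ Q : {Q : Finpartition (Finset.Icc 1 n) // Q.parts.card = k}, ∀ q : Q.1.parts,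
        {w : PosWord // IsPrimeParking w ∧ w.length = q.1.card}) =>
      (⟨ofPartition x.1.1 x.2, by
        rw [numCols_eq]
        exact length_columnsOf.trans x.1.2⟩ : {u : RBiWord ⊤ n // u.numCols = k})) := by
  constructor
  · rintro ⟨⟨Q, hQ⟩, M⟩ ⟨⟨Q', hQ'⟩, M'⟩ h
    have h1 : columnsOf Q M = columnsOf Q' M' :=
      congrArg RBiWord.lam (congrArg Subtype.val h)
    have h2 : ∀ c, c ∈ columnsOf Q M ↔ c ∈ columnsOf Q' M' := fun c => by rw [h1]
    simp only [mem_columnsOf] at h2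
    obtain rfl : Q = Q' := by
      refine Finpartition.ext (Finset.ext fun q => ⟨fun hq => ?_, fun hq => ?_⟩)
      · exact ((h2 (q, (M ⟨q, hq⟩).1)).1 ⟨hq, rfl⟩).1
      · exact ((h2 (q, (M' ⟨q, hq⟩).1)).2 ⟨hq, rfl⟩).1
    obtain rfl : M = M' := by
      funext q
      exact Subtype.ext ((h2 (q.1, (M q).1)).1 ⟨q.2, rfl⟩).2
    rfl
  · rintro ⟨u, rfl⟩
    have h1 : ∀ q : u.partition.parts,
        ∃ w : {w : PosWord // IsPrimeParking w ∧ w.length = q.1.card}, (q.1, w.1) ∈ u.lam := by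
      intro q
      obtain ⟨c, hc, hcq⟩ := u.mem_partition_parts.1 q.2
      have hc' := u.mem_append_iff.2 hc
      refine ⟨⟨c.2, u.prime' c hc', by rw [u.length' c hc', hcq]⟩, ?_⟩
      change (q.1, c.2) ∈ u.lam
      rwa [← hcq]
    choose M hM using h1
    refine ⟨⟨⟨u.partition, u.card_partition_parts⟩, M⟩, Subtype.ext (ext_mem fun c => ?_)⟩
    refine mem_columnsOf.trans ⟨?_, fun hc => ?_⟩
    · rintro ⟨h, h2⟩
      have h3 := hM ⟨c.1, h⟩
      rwa [← h2] at h3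
    · have h : c.1 ∈ u.partition.parts := u.mem_partition_parts.2 ⟨c, hc, rfl⟩
      obtain ⟨x, hx⟩ := u.nonempty' c (u.mem_append_iff.2 hc)
      exact ⟨h, congrArg Prod.snd (u.eq_of_mem_of_mem hc (hM ⟨c.1, h⟩) hx hx)⟩

theorem card_numCols_eq (n k : ℕ) :
    Nat.card {u : RBiWord ⊤ n // u.numCols = k} = ACoeff ⊤ n k := by
  rw [← Nat.card_congr (Equiv.ofBijective _ (ofPartition_bijective k)), Nat.card_sigma,
    ACoeff_top_eq_partitionSum, partitionSum,
    Finset.sum_subtype _ (p := fun Q : Finpartition (Finset.Icc 1 n) => Q.parts.card = k) (by simp)]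
  refine Finset.sum_congr rfl fun Q _ => ?_
  simp only [Nat.card_pi, card_primeWords]
  exact Finset.prod_coe_sort Q.1.parts fun q => (q.card - 1) ^ (q.card - 1)

instance finite_numCols_eq (n k : ℕ) : Finite {u : RBiWord ⊤ n // u.numCols = k} :=
  Finite.of_equiv _ (Equiv.ofBijective _ (ofPartition_bijective k))

/-- The vectors `G` of the `∞`-bi-words are pairwise distinct. -/
noncomputable def equivGVectors (K : Type*) [Field K] (n k : ℕ) :
    {u : RBiWord ⊤ n // u.numCols = k} ≃ GVectors K ⊤ n k :=
  Equiv.ofBijective (fun u => ⟨u.1.G K, u.1, u.2, rfl⟩)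
    ⟨fun _ _ h => Subtype.ext (G_injective K (congrArg Subtype.val h)),
      fun ⟨_, u, hu, hg⟩ => ⟨⟨u, hu⟩, Subtype.ext hg⟩⟩

end RBiWord

/-! ### The bijection and the enumeration -/

instance finite_labeledRootedTree (V : Type*) [Finite V] : Finite (LabeledRootedTree V) :=
  Finite.of_injective LabeledRootedTree.parent LabeledRootedTree.parent_injective

theorem ncard_treesMDChain_eq_ACoeff (n k : ℕ) (hk : 1 ≤ k) :
    (treesMDChain n k).ncard = ACoeff ⊤ n k := by
  rw [ncard_treesMDChain n k hk, card_smallRootForests satisfiesBlockRecursion_ACoeff_top,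
    Fintype.card_fin]

theorem ncard_treesMD_eq_ACoeff (n k : ℕ) :
    (treesMD n k).ncard = ACoeff ⊤ (n + 1) (k + 1) * k ! := by
  rw [ncard_treesMD, card_smallRootForests satisfiesBlockRecursion_ACoeff_top, Fintype.card_fin]

theorem mainTheorem5 (K : Type*) [Field K] [CharZero K] (n k : ℕ) (hn : 1 ≤ n) (hk : 1 ≤ k)
    (hkn : k ≤ n) :
    Nonempty (GVectors K ⊤ n k ≃ treesMDChain n k) ∧
    (ACoeff ⊤ (n + 1) (k + 1) : ℚ) = ((treesMD n k).ncard : ℚ) / (k ! : ℚ) ∧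
    ((treesMD n k).ncard : ℚ) / (k ! : ℚ) =
      ∑ m ∈ Finset.Icc k n,
        (n.choose m : ℚ) * (Nat.stirlingSecond m k : ℚ) * ((n : ℚ) - (k : ℚ)) ^ (n - m) ∧
    ∑ m ∈ Finset.Icc k n,
        (n.choose m : ℚ) * (Nat.stirlingSecond m k : ℚ) * ((n : ℚ) - (k : ℚ)) ^ (n - m) =
      1 / (k ! : ℚ) * ∑ i ∈ Finset.range (k + 1),
        (-1 : ℚ) ^ i * (k.choose i : ℚ) * ((n : ℚ) - (i : ℚ)) ^ n := by
  have h0 : (k ! : ℚ) ≠ 0 := by exact_mod_cast Nat.factorial_ne_zero k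
  have hA : (ACoeff ⊤ (n + 1) (k + 1) : ℚ) = ((treesMD n k).ncard : ℚ) / (k ! : ℚ) := by
    rw [ncard_treesMD_eq_ACoeff, Nat.cast_mul, mul_div_cancel_right₀ _ h0]
  refine ⟨?_, hA, ?_, sum_choose_mul_stirlingSecond n k⟩
  · have hcard : Nat.card {u : RBiWord ⊤ n // u.numCols = k} = Nat.card (treesMDChain n k) := by
      rw [RBiWord.card_numCols_eq, Nat.card_coe_set_eq, ncard_treesMDChain_eq_ACoeff n k hk]
    exact (Finite.card_eq.1 hcard).map fun e => (RBiWord.equivGVectors K n k).symm.trans e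
  · rw [← hA, sum_choose_mul_stirlingSecond, one_div, eq_inv_mul_iff_mul_eq₀ h0,
      satisfiesBlockRecursion_ACoeff_top.factorial_mul_succ_succ]
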